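/- A Hanner polytope is a set obtained from symmetric intervals $[-v,v]$, $v\neq 0$, by repeatedly forming $\ell_1$-sums $A\oplus_1 B=\operatorname{conv}(A\cup B)$ and $\ell_\infty$-sums $A\oplus_\infty B=A+B$ of two Hanner polytopes $A,B$ with $\operatorname{span}(A)\cap\operatorname{span}(B)=\{0\}$; it is a Hanner polytope in $\mathbb R^n$ if it is contained in $\mathbb R^n$ and has nonempty interior there. A (proper) face of a polytope is its intersection with a supporting hyperplane, and a flag over a polytope $P\subset\mathbb R^n$ is a sequence $\mathbb F=(F^0\subset F^1\subset\dots\subset F^{n-1})$ of faces of $P$ with $\dim F^k=k$ for $0\le k\le n-1$. For a face $F$, let $c_F$ be its centroid, i.e. the mean of $x$ over $F$ with respect to $(\dim F)$-dimensional volume. Proposition. Let $H$ be a Hanner polytope in $\mathbb R^n$. Then the simplex $$C_{\mathbb F}=\operatorname{conv}\{0,c_{F^0},\dots,c_{F^{n-1}}\}$$ has the same $n$-dimensional volume for every flag $\mathbb F$ over $H$; that is, $|C_{\mathbb F}|=|C_{\mathbb G}|$ for any two flags $\mathbb F,\mathbb G$ over $H$. -/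

import Mathlib

open scoped Pointwise MeasureTheory

noncomputable section

namespace HannerPolytope

/-- The `ℓ_1`-sum of two convex sets: the convex hull of their union. -/
def l1Sum {V : Type*} [AddCommGroup V] [Module ℝ V] (A B : Set V) : Set V :=
  convexHull ℝ (A ∪ B)

/-- The `ℓ_∞`-sum of two convex sets: their Minkowski sum. -/
def lInftySum {V : Type*} [AddCommGroup V] [Module ℝ V] (A B : Set V) : Set V :=
  A + B

/-- Hanner polytopes, of any dimension, lying in a real vector space `V`: the symmetric intervals
`[-v, v]` with `v ≠ 0`, and all `ℓ_1`- and `ℓ_∞`-sums of two Hanner polytopes whose linear spans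
meet only in the origin. -/
inductive IsHanner {V : Type*} [AddCommGroup V] [Module ℝ V] : Set V → Prop
  | interval (v : V) (hv : v ≠ 0) : IsHanner (segment ℝ (-v) v)
  | l1 (A B : Set V) (hA : IsHanner A) (hB : IsHanner B)
      (hAB : Disjoint (Submodule.span ℝ A) (Submodule.span ℝ B)) : IsHanner (l1Sum A B)
  | lInfty (A B : Set V) (hA : IsHanner A) (hB : IsHanner B)
      (hAB : Disjoint (Submodule.span ℝ A) (Submodule.span ℝ B)) : IsHanner (lInftySum A B)

/-- A Hanner polytope in `ℝⁿ`, as a convex body: it has nonempty interior in `ℝⁿ`. -/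
def IsHannerBody {n : ℕ} (H : Set (EuclideanSpace ℝ (Fin n))) : Prop :=
  IsHanner H ∧ (interior H).Nonempty

/-- A (proper) face of `P`: the intersection of `P` with a supporting hyperplane
`{x | l x = a}` of `P`. -/
def IsFace {V : Type*} [AddCommGroup V] [Module ℝ V] (P F : Set V) : Prop :=
  ∃ (l : V →ₗ[ℝ] ℝ) (a : ℝ), l ≠ 0 ∧ (∀ x ∈ P, l x ≤ a) ∧ F = {x ∈ P | l x = a} ∧ F.Nonempty

/-- The dimension of a nonempty set `A`: the dimension of the linear span of `A - A`. -/
def dim {V : Type*} [AddCommGroup V] [Module ℝ V] (A : Set V) : ℕ :=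
  Module.finrank ℝ (vectorSpan ℝ A)

/-- A flag over a polytope `P` in `ℝⁿ`: faces `F⁰ ⊆ F¹ ⊆ … ⊆ Fⁿ⁻¹` of `P` with `dim Fᵏ = k`. -/
structure IsFlag {n : ℕ} (P : Set (EuclideanSpace ℝ (Fin n)))
    (F : Fin n → Set (EuclideanSpace ℝ (Fin n))) : Prop where
  isFace : ∀ k, IsFace P (F k)
  dim_eq : ∀ k, dim (F k) = (k : ℕ)
  mono : Monotone F

/-- The centroid of a set `A` of dimension `k`: the mean of the position vector over `A` with
respect to `k`-dimensional volume (the `k`-dimensional Hausdorff measure, normalized so that it is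
Lebesgue measure on `k`-dimensional Euclidean spaces). -/
def centroid {n : ℕ} (A : Set (EuclideanSpace ℝ (Fin n))) : EuclideanSpace ℝ (Fin n) :=
  ⨍ x in A, x ∂μHE[dim A]

/-- The simplex `conv {0, c(F⁰), …, c(Fⁿ⁻¹)}` spanned by the origin and the centroids of the members
of a flag. -/
def flagSimplex {n : ℕ} (F : Fin n → Set (EuclideanSpace ℝ (Fin n))) :
    Set (EuclideanSpace ℝ (Fin n)) :=
  convexHull ℝ (insert 0 (Set.range fun k => centroid (F k)))

end HannerPolytope

end

open scoped Pointwise MeasureTheory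

noncomputable section

namespace HannerPolytope

open MeasureTheory Module

/-- A family of sets carrying a rank function that is strictly monotone for inclusion and bounded
by `a`. -/
structure IsRanked {V : Type*} (𝒜 : Set (Set V)) (ρ : Set V → ℕ) (a : ℕ) : Prop where
  rank_mono : ∀ X ∈ 𝒜, ∀ Y ∈ 𝒜, X ⊆ Y → ρ X ≤ ρ Y
  eq_of_subset : ∀ X ∈ 𝒜, ∀ Y ∈ 𝒜, X ⊆ Y → ρ X = ρ Y → X = Y
  rank_le : ∀ X ∈ 𝒜, ρ X ≤ a

/-- A maximal chain in a ranked family, with members of rank `0, 1, …, a`. -/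
structure IsMaximalChain {V : Type*} (𝒜 : Set (Set V)) (ρ : Set V → ℕ) (a : ℕ)
    (F : ℕ → Set V) : Prop where
  mem : ∀ k ≤ a, F k ∈ 𝒜
  rank : ∀ k ≤ a, ρ (F k) = k
  mono : ∀ i j, i ≤ j → j ≤ a → F i ⊆ F j

/-- The increments of a set function along a chain. -/
def increment {V : Type*} [AddCommGroup V] (f : Set V → V) (a : ℕ) (F : ℕ → Set V) : Fin a → V :=
  fun i => f (F (i + 1)) - f (F i)

/-- The wedge product of the increments of `f` is, up to sign, the same for all maximal chains. -/
def WedgeInvariant {V : Type*} [AddCommGroup V] [Module ℝ V] (𝒜 : Set (Set V)) (ρ : Set V → ℕ)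
    (a : ℕ) (f : Set V → V) : Prop :=
  ∀ (ω : V [⋀^Fin a]→ₗ[ℝ] ℝ) (F G : ℕ → Set V), IsMaximalChain 𝒜 ρ a F →
    IsMaximalChain 𝒜 ρ a G → |ω (increment f a F)| = |ω (increment f a G)|

/-- A chain whose ranks run from `0` to `a` in steps of at most one contains a maximal chain. -/
theorem IsRanked.exists_maximalChain {V : Type*} {𝒜 : Set (Set V)} {ρ : Set V → ℕ} {a : ℕ}
    (h : IsRanked 𝒜 ρ a) {n : ℕ} {E : ℕ → Set V} (hE : ∀ k ≤ n, E k ∈ 𝒜)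
    (hmono : ∀ i j, i ≤ j → j ≤ n → E i ⊆ E j) (h0 : ρ (E 0) = 0) (hn : ρ (E n) = a)
    (hstep : ∀ k < n, ρ (E (k + 1)) ≤ ρ (E k) + 1) :
    ∃ F, IsMaximalChain 𝒜 ρ a F ∧ ∀ k ≤ n, E k = F (ρ (E k)) := by
  have hex : ∀ i ≤ a, ∃ k ≤ n, ρ (E k) = i := by
    intro i
    induction i with
    | zero => exact fun _ => ⟨0, Nat.zero_le _, h0⟩
    | succ i ih =>
      intro hi
      have hP : ∃ k, k ≤ n ∧ i + 1 ≤ ρ (E k) := ⟨n, le_rfl, by omega⟩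
      classical
      obtain ⟨h1, h2⟩ := Nat.find_spec hP
      have hne : Nat.find hP ≠ 0 := by
        intro h'
        rw [h', h0] at h2
        omega
      obtain ⟨m, hm⟩ := Nat.exists_eq_succ_of_ne_zero hne
      have hlt := Nat.find_min hP (m := m) (by omega)
      rw [hm] at h1 h2
      have := hstep m (by omega)
      exact ⟨m + 1, h1, by simp only [Nat.succ_eq_add_one] at h2; omega⟩
  choose! κ hκ hκ' using hex
  refine ⟨fun i => E (κ i), ⟨fun k hk => hE _ (hκ k hk), hκ', ?_⟩, ?_⟩
  · intro i j hij hj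
    by_contra hcon
    have hlt : κ j < κ i := by
      by_contra h'
      exact hcon (hmono _ _ (not_lt.1 h') (hκ j hj))
    have hsub := hmono _ _ hlt.le (hκ i (hij.trans hj))
    have hle := h.rank_mono _ (hE _ (hκ j hj)) _ (hE _ (hκ i (hij.trans hj))) hsub
    rw [hκ' j hj, hκ' i (hij.trans hj)] at hle
    exact hcon (by rw [le_antisymm hij hle])
  · intro k hk
    have hka := h.rank_le _ (hE k hk)
    have hr := hκ' _ hka
    have hm := hκ _ hka
    rcases le_total k (κ (ρ (E k))) with h' | h'
    · exact h.eq_of_subset _ (hE k hk) _ (hE _ hm) (hmono _ _ h' hm) hr.symm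
    · exact (h.eq_of_subset _ (hE _ hm) _ (hE k hk) (hmono _ _ h' hk) hr).symm

/-- A maximal chain in a product of ranked families is a shuffle of maximal chains in the
factors. -/
theorem exists_shuffle {V : Type*} [AddCommGroup V] {𝒜 ℬ ℋ : Set (Set V)}
    {ρA ρB ρH : Set V → ℕ} {a b : ℕ} (hA : IsRanked 𝒜 ρA a) (hB : IsRanked ℬ ρB b)
    {pA pB : Set V → Set V} (hpA : ∀ X ∈ ℋ, pA X ∈ 𝒜) (hpB : ∀ X ∈ ℋ, pB X ∈ ℬ)
    (hmA : ∀ X ∈ ℋ, ∀ Y ∈ ℋ, X ⊆ Y → pA X ⊆ pA Y)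
    (hmB : ∀ X ∈ ℋ, ∀ Y ∈ ℋ, X ⊆ Y → pB X ⊆ pB Y)
    (hρ : ∀ X ∈ ℋ, ρH X = ρA (pA X) + ρB (pB X))
    {fA fB fH : Set V → V} (hf : ∀ X ∈ ℋ, fH X = fA (pA X) + fB (pB X))
    {F : ℕ → Set V} (hF : IsMaximalChain ℋ ρH (a + b) F) :
    ∃ FA FB, IsMaximalChain 𝒜 ρA a FA ∧ IsMaximalChain ℬ ρB b FB ∧
      ∃ s : Fin (a + b) ≃ Fin a ⊕ Fin b,
        increment fH (a + b) F = Sum.elim (increment fA a FA) (increment fB b FB) ∘ s := by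
  have hsum : ∀ k ≤ a + b, ρA (pA (F k)) + ρB (pB (F k)) = k := fun k hk => by
    rw [← hρ _ (hF.mem k hk), hF.rank k hk]
  have hAmem : ∀ k ≤ a + b, pA (F k) ∈ 𝒜 := fun k hk => hpA _ (hF.mem k hk)
  have hBmem : ∀ k ≤ a + b, pB (F k) ∈ ℬ := fun k hk => hpB _ (hF.mem k hk)
  have hAmono : ∀ i j, i ≤ j → j ≤ a + b → pA (F i) ⊆ pA (F j) := fun i j hij hj =>
    hmA _ (hF.mem i (hij.trans hj)) _ (hF.mem j hj) (hF.mono i j hij hj)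
  have hBmono : ∀ i j, i ≤ j → j ≤ a + b → pB (F i) ⊆ pB (F j) := fun i j hij hj =>
    hmB _ (hF.mem i (hij.trans hj)) _ (hF.mem j hj) (hF.mono i j hij hj)
  have hAr : ∀ i j, i ≤ j → j ≤ a + b → ρA (pA (F i)) ≤ ρA (pA (F j)) := fun i j hij hj =>
    hA.rank_mono _ (hAmem i (hij.trans hj)) _ (hAmem j hj) (hAmono i j hij hj)
  have hBr : ∀ i j, i ≤ j → j ≤ a + b → ρB (pB (F i)) ≤ ρB (pB (F j)) := fun i j hij hj =>
    hB.rank_mono _ (hBmem i (hij.trans hj)) _ (hBmem j hj) (hBmono i j hij hj)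
  have h0 := hsum 0 (Nat.zero_le _)
  have hn := hsum (a + b) le_rfl
  have hna := hA.rank_le _ (hAmem (a + b) le_rfl)
  have hnb := hB.rank_le _ (hBmem (a + b) le_rfl)
  obtain ⟨FA, hFA, hFA'⟩ := hA.exists_maximalChain (E := fun k => pA (F k)) hAmem hAmono
    (by omega) (by omega) (fun k hk => by
      have h1 := hsum k hk.le
      have h2 := hsum (k + 1) hk
      have h3 := hBr k (k + 1) (Nat.le_succ _) hk
      omega)
  obtain ⟨FB, hFB, hFB'⟩ := hB.exists_maximalChain (E := fun k => pB (F k)) hBmem hBmono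
    (by omega) (by omega) (fun k hk => by
      have h1 := hsum k hk.le
      have h2 := hsum (k + 1) hk
      have h3 := hAr k (k + 1) (Nat.le_succ _) hk
      omega)
  have hcase : ∀ k < a + b,
      (ρA (pA (F (k + 1))) = ρA (pA (F k)) + 1 ∧ ρB (pB (F (k + 1))) = ρB (pB (F k)) ∧
        ρA (pA (F k)) < a) ∨
      (ρA (pA (F (k + 1))) = ρA (pA (F k)) ∧ ρB (pB (F (k + 1))) = ρB (pB (F k)) + 1 ∧
        ρB (pB (F k)) < b) := by
    intro k hk
    have h1 := hsum k hk.le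
    have h2 := hsum (k + 1) hk
    have h3 := hAr k (k + 1) (Nat.le_succ _) hk
    have h4 := hBr k (k + 1) (Nat.le_succ _) hk
    have h5 := hA.rank_le _ (hAmem (k + 1) hk)
    have h6 := hB.rank_le _ (hBmem (k + 1) hk)
    omega
  have hex : ∀ k : Fin (a + b), ∃ t : Fin a ⊕ Fin b,
      (∀ i, t = Sum.inl i → ρA (pA (F (k + 1))) = ρA (pA (F k)) + 1 ∧
        (i : ℕ) = ρA (pA (F k))) ∧
      (∀ j, t = Sum.inr j → ρB (pB (F (k + 1))) = ρB (pB (F k)) + 1 ∧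
        (j : ℕ) = ρB (pB (F k))) ∧
      increment fH (a + b) F k = Sum.elim (increment fA a FA) (increment fB b FB) t := by
    intro k
    have hk := k.2
    have e1 : fH (F (k + 1)) = fA (FA (ρA (pA (F (k + 1))))) + fB (FB (ρB (pB (F (k + 1))))) := by
      rw [hf _ (hF.mem _ hk), ← hFA' _ hk, ← hFB' _ hk]
    have e2 : fH (F k) = fA (FA (ρA (pA (F k)))) + fB (FB (ρB (pB (F k)))) := by
      rw [hf _ (hF.mem _ hk.le), ← hFA' _ hk.le, ← hFB' _ hk.le]
    rcases hcase k hk with ⟨h1, h2, h3⟩ | ⟨h1, h2, h3⟩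
    · refine ⟨Sum.inl ⟨_, h3⟩, ?_, by simp, ?_⟩
      · rintro i hi
        obtain rfl := Sum.inl_injective hi
        exact ⟨h1, rfl⟩
      · simp only [increment, Sum.elim_inl]
        rw [e1, e2, h1, h2]
        abel
    · refine ⟨Sum.inr ⟨_, h3⟩, by simp, ?_, ?_⟩
      · rintro i hi
        obtain rfl := Sum.inr_injective hi
        exact ⟨h2, rfl⟩
      · simp only [increment, Sum.elim_inr]
        rw [e1, e2, h1, h2]
        abel
  choose s hs1 hs2 hs3 using hex
  have hlt : ∀ k k' : Fin (a + b), k < k' → s k ≠ s k' := by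
    intro k k' hkk heq
    have hk1 : (k : ℕ) + 1 ≤ k' := hkk
    have hk2 := k'.2.le
    rcases hsk : s k with i | j
    · obtain ⟨h1, h2⟩ := hs1 k i hsk
      obtain ⟨h3, h4⟩ := hs1 k' i (heq ▸ hsk)
      have := hAr _ _ hk1 hk2
      omega
    · obtain ⟨h1, h2⟩ := hs2 k j hsk
      obtain ⟨h3, h4⟩ := hs2 k' j (heq ▸ hsk)
      have := hBr _ _ hk1 hk2
      omega
  have hinj : Function.Injective s := by
    intro k k' h
    rcases lt_trichotomy k k' with h' | h' | h'
    · exact absurd h (hlt _ _ h')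
    · exact h'
    · exact absurd h.symm (hlt _ _ h')
  have hbij : Function.Bijective s :=
    (Fintype.bijective_iff_injective_and_card s).2 ⟨hinj, by simp⟩
  exact ⟨FA, FB, hFA, hFB, Equiv.ofBijective s hbij, funext fun k => hs3 k⟩

/-- Fixing the second half of the arguments of an alternating map. -/
def fixRight {V : Type*} [AddCommGroup V] [Module ℝ V] {ι κ : Type*}
    (ω : V [⋀^ι ⊕ κ]→ₗ[ℝ] ℝ) (y : κ → V) : V [⋀^ι]→ₗ[ℝ] ℝ where
  toFun x := ω (Sum.elim x y)
  map_update_add' x i u v := by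
    classical
    simp only [← Sum.update_elim_inl]
    convert ω.map_update_add (Sum.elim x y) (Sum.inl i) u v
  map_update_smul' x i c u := by
    classical
    simp only [← Sum.update_elim_inl]
    convert ω.map_update_smul (Sum.elim x y) (Sum.inl i) c u
  map_eq_zero_of_eq' x i j h hij :=
    ω.map_eq_zero_of_eq (Sum.elim x y) (i := Sum.inl i) (j := Sum.inl j) h (by simpa using hij)

theorem abs_map_comp_equiv {V : Type*} [AddCommGroup V] [Module ℝ V] {ι κ : Type*} [Fintype ι]
    [Fintype κ] (ω : V [⋀^ι]→ₗ[ℝ] ℝ) (s t : ι ≃ κ) (v : κ → V) : |ω (v ∘ s)| = |ω (v ∘ t)| := by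
  classical
  have h : v ∘ s = (v ∘ t) ∘ (s.trans t.symm) := by
    ext i
    simp
  rw [h, ω.map_perm]
  rcases Int.units_eq_one_or (Equiv.Perm.sign (s.trans t.symm)) with h | h <;> simp [h]

/-- Wedge invariance of a product of ranked families follows from that of the factors. -/
theorem WedgeInvariant.prod {V : Type*} [AddCommGroup V] [Module ℝ V] {𝒜 ℬ ℋ : Set (Set V)}
    {ρA ρB ρH : Set V → ℕ} {a b : ℕ} (hA : IsRanked 𝒜 ρA a) (hB : IsRanked ℬ ρB b)
    {pA pB : Set V → Set V} (hpA : ∀ X ∈ ℋ, pA X ∈ 𝒜) (hpB : ∀ X ∈ ℋ, pB X ∈ ℬ)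
    (hmA : ∀ X ∈ ℋ, ∀ Y ∈ ℋ, X ⊆ Y → pA X ⊆ pA Y)
    (hmB : ∀ X ∈ ℋ, ∀ Y ∈ ℋ, X ⊆ Y → pB X ⊆ pB Y)
    (hρ : ∀ X ∈ ℋ, ρH X = ρA (pA X) + ρB (pB X))
    {fA fB fH : Set V → V} (hf : ∀ X ∈ ℋ, fH X = fA (pA X) + fB (pB X))
    (hwA : WedgeInvariant 𝒜 ρA a fA) (hwB : WedgeInvariant ℬ ρB b fB) :
    WedgeInvariant ℋ ρH (a + b) fH := by
  intro ω F G hF hG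
  obtain ⟨FA, FB, hFA, hFB, s, hs⟩ := exists_shuffle hA hB hpA hpB hmA hmB hρ hf hF
  obtain ⟨GA, GB, hGA, hGB, t, ht⟩ := exists_shuffle hA hB hpA hpB hmA hmB hρ hf hG
  rw [hs, ht, abs_map_comp_equiv ω t s]
  set ω' : V [⋀^Fin a ⊕ Fin b]→ₗ[ℝ] ℝ := ω.domDomCongr s
  have key : ∀ v, ω (v ∘ s) = ω' v := fun v => rfl
  rw [key, key]
  have h1 := hwA (fixRight ω' (increment fB b FB)) FA GA hFA hGA
  set ω'' : V [⋀^Fin b ⊕ Fin a]→ₗ[ℝ] ℝ := ω'.domDomCongr (Equiv.sumComm _ _)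
  have key2 : ∀ x y, ω' (Sum.elim x y) = fixRight ω'' x y := by
    intro x y
    change ω' _ = ω' _
    congr 1
    ext i
    rcases i with i | i <;> rfl
  have h2 := hwB (fixRight ω'' (increment fA a GA)) FB GB hFB hGB
  rw [← key2, ← key2] at h2
  exact Eq.trans h1 h2

/-- An alternating map evaluated on linear combinations of vectors. -/
theorem alternatingMap_sum_smul {V : Type*} [AddCommGroup V] [Module ℝ V] {ι : Type*} [Fintype ι]
    [DecidableEq ι] (ω : V [⋀^ι]→ₗ[ℝ] ℝ) (M : Matrix ι ι ℝ) (v : ι → V) :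
    ω (fun i => ∑ j, M i j • v j) = M.det * ω v := by
  set L : (ι → ℝ) →ₗ[ℝ] V := Fintype.linearCombination ℝ v
  have h := (ω.compLinearMap L).eq_smul_basis_det (Pi.basisFun ℝ ι)
  have h2 := congrArg (fun η : (ι → ℝ) [⋀^ι]→ₗ[ℝ] ℝ => η (fun i => M i)) h
  have h3 : (fun i => L (M i)) = fun i => ∑ j, M i j • v j := by
    ext i
    simp [L, Fintype.linearCombination_apply]
  have h4 : (fun i => L (Pi.basisFun ℝ ι i)) = v := by
    ext i
    simp [L]
  simp only [AlternatingMap.compLinearMap_apply, AlternatingMap.smul_apply, smul_eq_mul] at h2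
  rw [Pi.basisFun_det_apply] at h2
  change ω (fun i => L (M i)) = ω (fun i => L (Pi.basisFun ℝ ι i)) * _ at h2
  rw [h3, h4] at h2
  rw [h2, mul_comm]
  rfl

section Faces

variable {V : Type*} [AddCommGroup V] [Module ℝ V]

/-- The faces of `A` cut out by an affine hyperplane `l = 1`, including the empty face. -/
def properFaces (A : Set V) : Set (Set V) :=
  {X | ∃ l : V →ₗ[ℝ] ℝ, (∀ x ∈ A, l x ≤ 1) ∧ X = {x ∈ A | l x = 1}}

/-- The nonempty faces of `A`, including `A` itself. -/
def closedFaces (A : Set V) : Set (Set V) :=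
  {X | ∃ (l : V →ₗ[ℝ] ℝ) (c : ℝ), (∀ x ∈ A, l x ≤ c) ∧ X = {x ∈ A | l x = c} ∧ X.Nonempty}

/-- The dimension of the linear span. -/
def spanRank (X : Set V) : ℕ := Module.finrank ℝ (Submodule.span ℝ X)

theorem empty_mem_properFaces (A : Set V) : ∅ ∈ properFaces A :=
  ⟨0, by simp, by simp⟩

theorem self_mem_closedFaces {A : Set V} (h : A.Nonempty) : A ∈ closedFaces A :=
  ⟨0, 0, by simp, by simp, h⟩

theorem subset_of_mem_properFaces {A X : Set V} (h : X ∈ properFaces A) : X ⊆ A := by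
  obtain ⟨l, -, rfl⟩ := h
  exact fun x hx => hx.1

theorem subset_of_mem_closedFaces {A X : Set V} (h : X ∈ closedFaces A) : X ⊆ A := by
  obtain ⟨l, c, -, rfl, -⟩ := h
  exact fun x hx => hx.1

theorem nonempty_of_mem_closedFaces {A X : Set V} (h : X ∈ closedFaces A) : X.Nonempty := by
  obtain ⟨l, c, -, -, h⟩ := h
  exact h

theorem vectorSpan_le_span (X : Set V) : vectorSpan ℝ X ≤ Submodule.span ℝ X := by
  rw [vectorSpan_def, Submodule.span_le]
  rintro _ ⟨x, hx, y, hy, rfl⟩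
  exact Submodule.sub_mem _ (Submodule.subset_span hx) (Submodule.subset_span hy)

theorem vectorSpan_eq_span {X : Set V} (h : (0 : V) ∈ X) :
    vectorSpan ℝ X = Submodule.span ℝ X := by
  refine le_antisymm (vectorSpan_le_span X) (Submodule.span_le.2 fun x hx => ?_)
  simpa using vsub_mem_vectorSpan ℝ hx h

theorem eq_zero_of_mem_vectorSpan {X : Set V} {l : V →ₗ[ℝ] ℝ} {c : ℝ} (h : ∀ x ∈ X, l x = c)
    {v : V} (hv : v ∈ vectorSpan ℝ X) : l v = 0 := by
  have : vectorSpan ℝ X ≤ LinearMap.ker l := by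
    rw [vectorSpan_def, Submodule.span_le]
    rintro _ ⟨x, hx, y, hy, rfl⟩
    simp [h x hx, h y hy]
  exact this hv

theorem spanRank_mono [FiniteDimensional ℝ V] {X Y : Set V} (h : X ⊆ Y) : spanRank X ≤ spanRank Y :=
  Submodule.finrank_mono (Submodule.span_mono h)

theorem dim_mono [FiniteDimensional ℝ V] {X Y : Set V} (h : X ⊆ Y) : dim X ≤ dim Y :=
  Submodule.finrank_mono (vectorSpan_mono ℝ h)

theorem isRanked_properFaces [FiniteDimensional ℝ V] (A : Set V) :
    IsRanked (properFaces A) spanRank (spanRank A) where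
  rank_mono X _ Y _ h := spanRank_mono h
  rank_le X hX := spanRank_mono (subset_of_mem_properFaces hX)
  eq_of_subset X hX Y hY hXY hr := by
    refine hXY.antisymm fun y hy => ?_
    have hs : Submodule.span ℝ X = Submodule.span ℝ Y :=
      Submodule.eq_of_le_of_finrank_eq (Submodule.span_mono hXY) hr
    have hyX : y ∈ Submodule.span ℝ X := hs ▸ Submodule.subset_span hy
    obtain ⟨l, hl, rfl⟩ := hX
    obtain ⟨m, hm, rfl⟩ := hY
    refine ⟨hy.1, ?_⟩
    have hle : Submodule.span ℝ {x ∈ A | l x = 1} ≤ LinearMap.ker (l - m) := by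
      rw [Submodule.span_le]
      intro x hx
      simp [hx.2, (hXY hx).2]
    have := hle hyX
    simp only [LinearMap.mem_ker, LinearMap.sub_apply, hy.2] at this
    linarith

theorem isRanked_closedFaces [FiniteDimensional ℝ V]
    (A : Set V) : IsRanked (closedFaces A) dim (spanRank A) where
  rank_mono X _ Y _ h := dim_mono h
  rank_le X hX := (dim_mono (subset_of_mem_closedFaces hX)).trans
    (Submodule.finrank_mono (vectorSpan_le_span A))
  eq_of_subset X hX Y hY hXY hr := by
    refine hXY.antisymm fun y hy => ?_
    have hs : vectorSpan ℝ X = vectorSpan ℝ Y :=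
      Submodule.eq_of_le_of_finrank_eq (vectorSpan_mono ℝ hXY) hr
    obtain ⟨x, hx⟩ := nonempty_of_mem_closedFaces hX
    have hyx : y - x ∈ vectorSpan ℝ X := hs ▸ vsub_mem_vectorSpan ℝ hy (hXY hx)
    obtain ⟨l, c, hl, rfl, -⟩ := hX
    refine ⟨subset_of_mem_closedFaces hY hy, ?_⟩
    have := eq_zero_of_mem_vectorSpan (l := l) (c := c) (fun x hx => hx.2) hyx
    rw [map_sub, hx.2] at this
    linarith

theorem spanRank_eq_dim_add_one [FiniteDimensional ℝ V]
    {X : Set V} {l : V →ₗ[ℝ] ℝ} (hl : ∀ x ∈ X, l x = 1)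
    (hX : X.Nonempty) : spanRank X = dim X + 1 := by
  obtain ⟨x, hx⟩ := hX
  have hx0 : x ≠ 0 := by
    rintro rfl
    simpa using hl 0 hx
  have hspan : Submodule.span ℝ X = vectorSpan ℝ X ⊔ Submodule.span ℝ {x} := by
    refine le_antisymm (Submodule.span_le.2 fun y hy => ?_) (sup_le (vectorSpan_le_span X) ?_)
    · rw [← sub_add_cancel y x]
      exact Submodule.add_mem_sup (vsub_mem_vectorSpan ℝ hy hx) (Submodule.mem_span_singleton_self x)
    · exact Submodule.span_mono (by simpa using hx)
  have hdis : vectorSpan ℝ X ⊓ Submodule.span ℝ {x} = ⊥ := by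
    rw [Submodule.eq_bot_iff]
    rintro y ⟨hy1, hy2⟩
    obtain ⟨t, rfl⟩ := Submodule.mem_span_singleton.1 hy2
    have := eq_zero_of_mem_vectorSpan hl hy1
    rw [map_smul, hl x hx, smul_eq_mul, mul_one] at this
    simp [this]
  have := Submodule.finrank_sup_add_finrank_inf_eq (vectorSpan ℝ X) (Submodule.span ℝ {x})
  rw [hdis, finrank_bot, add_zero, finrank_span_singleton hx0] at this
  rw [spanRank, hspan, this, dim]

theorem closedFaces_mem_properFaces {A : Set V} (h0 : (0 : V) ∈ A) (hneg : ∀ x ∈ A, -x ∈ A)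
    {X : Set V} (hX : X ∈ closedFaces A) (hne : X ≠ A) : X ∈ properFaces A := by
  obtain ⟨l, c, hl, rfl, -⟩ := hX
  have hc : 0 ≤ c := by simpa using hl 0 h0
  rcases hc.eq_or_lt with rfl | hc
  · refine absurd ?_ hne
    ext x
    refine ⟨fun h => h.1, fun h => ⟨h, le_antisymm (hl x h) ?_⟩⟩
    have := hl _ (hneg x h)
    rw [map_neg] at this
    linarith
  · refine ⟨c⁻¹ • l, fun x hx => ?_, ?_⟩
    · simp only [LinearMap.smul_apply, smul_eq_mul]
      rw [inv_mul_le_iff₀ hc, mul_one]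
      exact hl x hx
    · ext x
      simp only [Set.mem_ofPred_eq, LinearMap.smul_apply, smul_eq_mul]
      rw [inv_mul_eq_one₀ hc.ne', eq_comm]

theorem properFaces_mem_closedFaces {A X : Set V} (hX : X ∈ properFaces A) (hne : X.Nonempty) :
    X ∈ closedFaces A := by
  obtain ⟨l, hl, rfl⟩ := hX
  exact ⟨l, 1, hl, rfl, hne⟩

theorem spanRank_eq_dim_add_one_of_mem [FiniteDimensional ℝ V]
    {A X : Set V} (hX : X ∈ properFaces A) (hne : X.Nonempty) :
    spanRank X = dim X + 1 := by
  obtain ⟨l, hl, rfl⟩ := hX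
  exact spanRank_eq_dim_add_one (l := l) (fun x hx => hx.2) hne

@[simp] theorem spanRank_empty : spanRank (∅ : Set V) = 0 := by
  rw [spanRank, Submodule.span_empty, finrank_bot]

/-- A complete chain of proper faces. -/
structure IsProperFlag (A : Set V) (F : ℕ → Set V) : Prop where
  mem : ∀ k < spanRank A, F k ∈ properFaces A
  rank : ∀ k < spanRank A, spanRank (F k) = k + 1
  mono : ∀ i j, i ≤ j → j < spanRank A → F i ⊆ F j

theorem IsProperFlag.nonempty {A : Set V} {F : ℕ → Set V} (h : IsProperFlag A F) {k : ℕ}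
    (hk : k < spanRank A) : (F k).Nonempty := by
  rw [Set.nonempty_iff_ne_empty]
  intro h'
  have := h.rank k hk
  rw [h', spanRank_empty] at this
  omega

/-- The wedge product of the points `c (F k)`, for `F` a complete flag of proper faces, is
independent of the flag up to sign. -/
def FlagInvariant (c : Set V → V) (A : Set V) : Prop :=
  ∀ (ω : V [⋀^Fin (spanRank A)]→ₗ[ℝ] ℝ) (F G : ℕ → Set V), IsProperFlag A F → IsProperFlag A G →
    |ω fun i => c (F i)| = |ω fun i => c (G i)|

theorem isProperFlag_of_isMaximalChain {A : Set V} {F : ℕ → Set V}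
    (h : IsMaximalChain (properFaces A) spanRank (spanRank A) F) :
    IsProperFlag A fun k => F (k + 1) where
  mem k hk := h.mem _ hk
  rank k hk := h.rank _ hk
  mono i j hij hj := h.mono _ _ (by omega) (by omega)

theorem IsProperFlag.isMaximalChain {A : Set V} {F : ℕ → Set V} (h : IsProperFlag A F) :
    IsMaximalChain (properFaces A) spanRank (spanRank A)
      (fun k => Nat.casesOn k ∅ F) where
  mem k hk := by
    rcases k with _ | k
    · exact empty_mem_properFaces A
    · exact h.mem k hk
  rank k hk := by
    rcases k with _ | k
    · exact spanRank_empty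
    · exact h.rank k hk
  mono i j hij hj := by
    rcases i with _ | i
    · exact Set.empty_subset _
    · rcases j with _ | j
      · omega
      · exact h.mono i j (by omega) hj

theorem abs_map_increment_spanRank (c : Set V → V) {A : Set V} {F : ℕ → Set V}
    (h : IsMaximalChain (properFaces A) spanRank (spanRank A) F)
    (ω : V [⋀^Fin (spanRank A)]→ₗ[ℝ] ℝ) :
    |ω (increment (fun X => (spanRank X : ℝ) • c X) (spanRank A) F)| =
      ((spanRank A).factorial : ℝ) * |ω fun i => c (F (i + 1))| := by
  set M : Matrix (Fin (spanRank A)) (Fin (spanRank A)) ℝ := Matrix.of fun i j =>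
    if j = i then (i : ℝ) + 1 else if (j : ℕ) + 1 = i then -(i : ℝ) else 0 with hM
  have hdet : M.det = ((spanRank A).factorial : ℝ) := by
    rw [Matrix.det_of_isLowerTriangular]
    · simp only [hM, Matrix.of_apply, if_true]
      rw [Fin.prod_univ_eq_prod_range (fun i => (i : ℝ) + 1), ← Finset.prod_range_add_one_eq_factorial]
      push_cast
      rfl
    · intro i j hij
      have hij' : i < j := hij
      have h1 : j ≠ i := hij'.ne'
      have h2 : ¬ ((j : ℕ) + 1 = i) := by
        have : (i : ℕ) < j := hij'
        omega
      simp [hM, h1, h2]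
  have hsum : increment (fun X => (spanRank X : ℝ) • c X) (spanRank A) F =
      fun i => ∑ j, M i j • c (F (j + 1)) := by
    ext1 i
    have hi := i.2
    simp only [increment]
    rw [h.rank _ hi, h.rank _ hi.le]
    rcases Nat.eq_zero_or_pos (i : ℕ) with h0 | h0
    · rw [Finset.sum_eq_single i]
      · simp [hM, h0]
      · intro j _ hj
        have h2 : ¬ ((j : ℕ) + 1 = i) := by omega
        simp [hM, hj, h2]
      · simp
    · obtain ⟨m, hm⟩ := Nat.exists_eq_succ_of_ne_zero h0.ne'
      have hne : i ≠ ⟨m, by omega⟩ := by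
        intro h'
        have := congrArg Fin.val h'
        simp at this
        omega
      rw [Finset.sum_eq_add i ⟨m, by omega⟩ hne]
      · have h1 : ¬ ((⟨m, by omega⟩ : Fin (spanRank A)) = i) := fun h' => hne h'.symm
        simp only [hM, Matrix.of_apply, if_true, h1, if_false]
        have h2 : m + 1 = (i : ℕ) := hm.symm
        simp only [h2, if_true]
        push_cast
        rw [neg_smul, sub_eq_add_neg]
      · rintro j - ⟨hj1, hj2⟩
        have h2 : ¬ ((j : ℕ) + 1 = i) := by
          intro h'
          exact hj2 (Fin.ext (by simp; omega))
        simp [hM, hj1, h2]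
      · simp
      · simp
  rw [hsum, alternatingMap_sum_smul, hdet, abs_mul, Nat.abs_cast]

theorem FlagInvariant.wedgeInvariant_properFaces {c : Set V → V} {A : Set V}
    (h : FlagInvariant c A) :
    WedgeInvariant (properFaces A) spanRank (spanRank A) fun X => (spanRank X : ℝ) • c X := by
  intro ω F G hF hG
  rw [abs_map_increment_spanRank c hF, abs_map_increment_spanRank c hG,
    h ω _ _ (isProperFlag_of_isMaximalChain hF) (isProperFlag_of_isMaximalChain hG)]

theorem FlagInvariant.of_properFaces {c : Set V → V} {A : Set V}
    (h : WedgeInvariant (properFaces A) spanRank (spanRank A) fun X => (spanRank X : ℝ) • c X) :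
    FlagInvariant c A := by
  intro ω F G hF hG
  have := h ω _ _ hF.isMaximalChain hG.isMaximalChain
  rw [abs_map_increment_spanRank c hF.isMaximalChain,
    abs_map_increment_spanRank c hG.isMaximalChain] at this
  exact mul_left_cancel₀ (by positivity) this

theorem dim_eq_spanRank {A : Set V} (h0 : (0 : V) ∈ A) : dim A = spanRank A := by
  rw [dim, spanRank, vectorSpan_eq_span h0]

theorem top_eq_of_isMaximalChain [FiniteDimensional ℝ V]
    {A : Set V} (h0 : (0 : V) ∈ A) {F : ℕ → Set V}
    (h : IsMaximalChain (closedFaces A) dim (spanRank A) F) : F (spanRank A) = A := by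
  refine (isRanked_closedFaces A).eq_of_subset _ (h.mem _ le_rfl) _ (self_mem_closedFaces ⟨0, h0⟩)
    (subset_of_mem_closedFaces (h.mem _ le_rfl)) ?_
  rw [h.rank _ le_rfl, dim_eq_spanRank h0]

theorem isProperFlag_of_isMaximalChain_closedFaces [FiniteDimensional ℝ V]
    {A : Set V} (h0 : (0 : V) ∈ A)
    (hneg : ∀ x ∈ A, -x ∈ A) {F : ℕ → Set V}
    (h : IsMaximalChain (closedFaces A) dim (spanRank A) F) : IsProperFlag A F := by
  have hp : ∀ k < spanRank A, F k ∈ properFaces A := by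
    intro k hk
    refine closedFaces_mem_properFaces h0 hneg (h.mem k hk.le) ?_
    intro h'
    have := h.rank k hk.le
    rw [h', dim_eq_spanRank h0] at this
    omega
  refine ⟨hp, fun k hk => ?_, fun i j hij hj => h.mono i j hij hj.le⟩
  rw [spanRank_eq_dim_add_one_of_mem (hp k hk) (nonempty_of_mem_closedFaces (h.mem k hk.le)),
    h.rank k hk.le]

theorem IsProperFlag.isMaximalChain_closedFaces [FiniteDimensional ℝ V]
    {A : Set V} (h0 : (0 : V) ∈ A)
    {F : ℕ → Set V} (h : IsProperFlag A F) :
    IsMaximalChain (closedFaces A) dim (spanRank A) (fun k => if k < spanRank A then F k else A) where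
  mem k hk := by
    split_ifs with h'
    · exact properFaces_mem_closedFaces (h.mem k h') (h.nonempty h')
    · exact self_mem_closedFaces ⟨0, h0⟩
  rank k hk := by
    split_ifs with h'
    · have := h.rank k h'
      rw [spanRank_eq_dim_add_one_of_mem (h.mem k h') (h.nonempty h')] at this
      omega
    · rw [dim_eq_spanRank h0]
      omega
  mono i j hij hj := by
    split_ifs with h1 h2 h2
    · exact h.mono i j hij h2
    · exact subset_of_mem_properFaces (h.mem i h1)
    · omega
    · exact subset_rfl

theorem abs_map_increment_closedFaces [FiniteDimensional ℝ V]
    {c : Set V → V} {A : Set V} (h0 : (0 : V) ∈ A)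
    (hc : c A = 0) {F : ℕ → Set V}
    (h : IsMaximalChain (closedFaces A) dim (spanRank A) F)
    (ω : V [⋀^Fin (spanRank A)]→ₗ[ℝ] ℝ) :
    |ω (increment c (spanRank A) F)| = |ω fun i => c (F i)| := by
  set M : Matrix (Fin (spanRank A)) (Fin (spanRank A)) ℝ := Matrix.of fun i j =>
    if j = i then -1 else if (i : ℕ) + 1 = j then 1 else 0 with hM
  have hdet : |M.det| = 1 := by
    rw [Matrix.det_of_isUpperTriangular]
    · simp [hM, Finset.prod_const]
    · intro i j hij
      have hij' : j < i := hij
      have h1 : j ≠ i := hij'.ne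
      have h2 : ¬ ((i : ℕ) + 1 = j) := by
        have : (j : ℕ) < i := hij'
        omega
      simp [hM, h1, h2]
  have hsum : increment c (spanRank A) F = fun i => ∑ j, M i j • c (F j) := by
    ext1 i
    have hi := i.2
    simp only [increment]
    by_cases htop : (i : ℕ) + 1 = spanRank A
    · rw [htop, top_eq_of_isMaximalChain h0 h, hc, Finset.sum_eq_single i]
      · simp [hM]
      · intro j _ hj
        have h2 : ¬ ((i : ℕ) + 1 = j) := by omega
        simp [hM, hj, h2]
      · simp
    · have hne : i ≠ ⟨i + 1, by omega⟩ := by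
        intro h'
        have := congrArg Fin.val h'
        simp at this
      rw [Finset.sum_eq_add i ⟨i + 1, by omega⟩ hne]
      · have h1 : ¬ ((⟨i + 1, by omega⟩ : Fin (spanRank A)) = i) := fun h' => hne h'.symm
        simp only [hM, Matrix.of_apply, if_true, h1, if_false]
        rw [neg_one_smul, one_smul]
        abel
      · rintro j - ⟨hj1, hj2⟩
        have h2 : ¬ ((i : ℕ) + 1 = j) := by
          intro h'
          exact hj2 (Fin.ext (by simp; omega))
        simp [hM, hj1, h2]
      · simp
      · simp
  rw [hsum, alternatingMap_sum_smul, abs_mul, hdet, one_mul]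

theorem FlagInvariant.wedgeInvariant_closedFaces [FiniteDimensional ℝ V] {c : Set V → V} {A : Set V}
    (h : FlagInvariant c A) (h0 : (0 : V) ∈ A) (hneg : ∀ x ∈ A, -x ∈ A) (hc : c A = 0) :
    WedgeInvariant (closedFaces A) dim (spanRank A) c := by
  intro ω F G hF hG
  rw [abs_map_increment_closedFaces h0 hc hF, abs_map_increment_closedFaces h0 hc hG]
  exact h ω _ _ (isProperFlag_of_isMaximalChain_closedFaces h0 hneg hF)
    (isProperFlag_of_isMaximalChain_closedFaces h0 hneg hG)

theorem FlagInvariant.of_closedFaces [FiniteDimensional ℝ V]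
    {c : Set V → V} {A : Set V} (h0 : (0 : V) ∈ A)
    (hc : c A = 0) (h : WedgeInvariant (closedFaces A) dim (spanRank A) c) :
    FlagInvariant c A := by
  intro ω F G hF hG
  have := h ω _ _ (hF.isMaximalChain_closedFaces h0) (hG.isMaximalChain_closedFaces h0)
  rw [abs_map_increment_closedFaces h0 hc (hF.isMaximalChain_closedFaces h0),
    abs_map_increment_closedFaces h0 hc (hG.isMaximalChain_closedFaces h0)] at this
  simpa using this

end Faces

section Dimension

variable {V : Type*} [AddCommGroup V] [Module ℝ V]

theorem vectorSpan_add {A B : Set V} (hA : A.Nonempty) (hB : B.Nonempty) :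
    vectorSpan ℝ (A + B) = vectorSpan ℝ A ⊔ vectorSpan ℝ B := by
  obtain ⟨a, ha⟩ := hA
  obtain ⟨b, hb⟩ := hB
  apply le_antisymm
  · rw [vectorSpan_def, Submodule.span_le]
    rintro _ ⟨_, ⟨x, hx, y, hy, rfl⟩, _, ⟨x', hx', y', hy', rfl⟩, rfl⟩
    have : (x + y) -ᵥ (x' + y') = (x - x') + (y - y') := by
      rw [vsub_eq_sub]
      abel
    dsimp only
    rw [this]
    exact Submodule.add_mem_sup (vsub_mem_vectorSpan ℝ hx hx') (vsub_mem_vectorSpan ℝ hy hy')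
  · refine sup_le ?_ ?_
    · rw [vectorSpan_def, Submodule.span_le]
      rintro _ ⟨x, hx, x', hx', rfl⟩
      have := vsub_mem_vectorSpan ℝ (Set.add_mem_add hx hb) (Set.add_mem_add hx' hb)
      simpa using this
    · rw [vectorSpan_def, Submodule.span_le]
      rintro _ ⟨x, hx, x', hx', rfl⟩
      have := vsub_mem_vectorSpan ℝ (Set.add_mem_add ha hx) (Set.add_mem_add ha hx')
      simpa using this

theorem span_convexHull (A : Set V) :
    Submodule.span ℝ (convexHull ℝ A) = Submodule.span ℝ A :=
  le_antisymm (Submodule.span_le.2 (convexHull_min Submodule.subset_span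
    (Submodule.convex _))) (Submodule.span_mono (subset_convexHull ℝ A))

variable [FiniteDimensional ℝ V]

theorem finrank_sup_of_disjoint {p q : Submodule ℝ V} (h : Disjoint p q) :
    finrank ℝ ↥(p ⊔ q) = finrank ℝ p + finrank ℝ q := by
  have := Submodule.finrank_sup_add_finrank_inf_eq p q
  rwa [h.eq_bot, finrank_bot, add_zero] at this

theorem dim_add {A B : Set V} (hA : A.Nonempty) (hB : B.Nonempty)
    (h : Disjoint (vectorSpan ℝ A) (vectorSpan ℝ B)) : dim (A + B) = dim A + dim B := by
  rw [dim, vectorSpan_add hA hB, finrank_sup_of_disjoint h]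
  rfl

theorem spanRank_convexHull_union {A B : Set V}
    (h : Disjoint (Submodule.span ℝ A) (Submodule.span ℝ B)) :
    spanRank (convexHull ℝ (A ∪ B)) = spanRank A + spanRank B := by
  rw [spanRank, span_convexHull, Submodule.span_union, finrank_sup_of_disjoint h]
  rfl

end Dimension

theorem mem_convexHull_union_iff {V : Type*} [AddCommGroup V] [Module ℝ V] {A B : Set V}
    (hA : Convex ℝ A) (hB : Convex ℝ B) (hA' : A.Nonempty) (hB' : B.Nonempty) {x : V} :
    x ∈ convexHull ℝ (A ∪ B) ↔
      ∃ t : ℝ, 0 ≤ t ∧ t ≤ 1 ∧ ∃ a ∈ A, ∃ b ∈ B, x = (1 - t) • a + t • b := by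
  rw [hA.convexHull_union hB hA' hB', mem_convexJoin]
  constructor
  · rintro ⟨a, ha, b, hb, s, t, hs, ht, hst, rfl⟩
    exact ⟨t, ht, by linarith, a, ha, b, hb, by rw [← hst, add_sub_cancel_right]⟩
  · rintro ⟨t, ht, ht', a, ha, b, hb, rfl⟩
    exact ⟨a, ha, b, hb, 1 - t, t, by linarith, ht, by ring, rfl⟩

theorem isCompact_convexHull_union {V : Type*} [NormedAddCommGroup V] [NormedSpace ℝ V]
    {A B : Set V} (hA : IsCompact A) (hB : IsCompact B) (hA' : Convex ℝ A) (hB' : Convex ℝ B) :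
    IsCompact (convexHull ℝ (A ∪ B)) := by
  rcases A.eq_empty_or_nonempty with rfl | hAn
  · rwa [Set.empty_union, hB'.convexHull_eq]
  rcases B.eq_empty_or_nonempty with rfl | hBn
  · rwa [Set.union_empty, hA'.convexHull_eq]
  have : convexHull ℝ (A ∪ B) =
      (fun p : ℝ × V × V => (1 - p.1) • p.2.1 + p.1 • p.2.2) '' (Set.Icc 0 1 ×ˢ A ×ˢ B) := by
    ext x
    rw [mem_convexHull_union_iff hA' hB' hAn hBn]
    constructor
    · rintro ⟨t, h0, h1, a, ha, b, hb, rfl⟩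
      exact ⟨(t, a, b), ⟨⟨h0, h1⟩, ha, hb⟩, rfl⟩
    · rintro ⟨⟨t, a, b⟩, ⟨⟨h0, h1⟩, ha, hb⟩, rfl⟩
      exact ⟨t, h0, h1, a, ha, b, hb, rfl⟩
  rw [this]
  exact (isCompact_Icc.prod (hA.prod hB)).image (by fun_prop)

variable {n : ℕ}

/-- The Euclidean Hausdorff measure, transported by an injective affine map, is a multiple of any
Haar measure on the source. -/
theorem exists_euclideanHausdorffMeasure_image {U : Type*} [NormedAddCommGroup U] [NormedSpace ℝ U]
    [FiniteDimensional ℝ U] [MeasurableSpace U] [BorelSpace U] (μ : Measure U) [μ.IsAddHaarMeasure]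
    (L : U →ₗ[ℝ] EuclideanSpace ℝ (Fin n)) (hL : Function.Injective L)
    (v : EuclideanSpace ℝ (Fin n)) :
    ∃ c : ENNReal, c ≠ 0 ∧ c ≠ ⊤ ∧ ∀ s : Set U, MeasurableSet s →
      μHE[finrank ℝ U] ((fun u => v + L u) '' s) = c * μ s := by
  have hfr : finrank ℝ U = finrank ℝ (EuclideanSpace ℝ (Fin (finrank ℝ U))) := by simp
  let T : U ≃L[ℝ] EuclideanSpace ℝ (Fin (finrank ℝ U)) := ContinuousLinearEquiv.ofFinrankEq hfr
  let g : EuclideanSpace ℝ (Fin (finrank ℝ U)) →ₗ[ℝ] EuclideanSpace ℝ (Fin n) :=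
    L ∘ₗ (T.symm : _ →ₗ[ℝ] U)
  have hg : Function.Injective g := hL.comp T.symm.injective
  have hnd : 0 < g.normDet :=
    lt_of_le_of_ne g.normDet_nonneg (Ne.symm ((g.normDet_ne_zero_tfae.out 0 4).2 hg))
  have hhaar : (volume.map T.symm : Measure U).IsAddHaarMeasure := inferInstance
  have hsm := Measure.isAddLeftInvariant_eq_smul (volume.map T.symm : Measure U) μ
  set k := (volume.map T.symm : Measure U).addHaarScalarFactor μ with hk
  have hk0 : k ≠ 0 := (Measure.addHaarScalarFactor_pos_of_isAddHaarMeasure _ _).ne'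
  refine ⟨ENNReal.ofReal g.normDet * k, ?_, ?_, fun s hs => ?_⟩
  · simp [hnd, hk0]
  · exact ENNReal.mul_ne_top ENNReal.ofReal_ne_top ENNReal.coe_ne_top
  · have h1 : (fun u => v + L u) '' s = (fun x => v + x) '' (g '' (T '' s)) := by
      simp [Set.image_image, g]
    have h2 := g.euclideanHausdorffMeasure_image_eq_normDet_mul_volume (T '' s)
    rw [← hfr] at h2
    rw [h1, (isometry_add_left v).euclideanHausdorffMeasure_image, h2]
    have h3 : volume (T '' s) = (volume.map T.symm : Measure U) s := by
      rw [Measure.map_apply T.symm.continuous.measurable hs]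
      congr 1
      exact T.toEquiv.image_eq_preimage_symm s
    rw [h3, hsm, mul_assoc]
    rfl

theorem vectorSpan_preimage_eq_top {U : Type*} [AddCommGroup U] [Module ℝ U]
    [FiniteDimensional ℝ U] {V : Type*} [AddCommGroup V] [Module ℝ V]
    (L : U →ₗ[ℝ] V) (hL : Function.Injective L) (v : V) {C : Set V}
    (hC : C ⊆ Set.range fun u => v + L u) (hdim : finrank ℝ U = dim C) :
    vectorSpan ℝ ((fun u => v + L u) ⁻¹' C) = ⊤ := by
  have himage : (fun u => v + L u) '' ((fun u => v + L u) ⁻¹' C) = C :=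
    Set.image_preimage_eq_of_subset hC
  apply Submodule.eq_top_of_finrank_eq
  rw [hdim, dim]
  conv_rhs => rw [← himage]
  have := AffineMap.map_vectorSpan (L.toAffineMap + AffineMap.const ℝ U v)
    (s := (fun u => v + L u) ⁻¹' C)
  have h2 : ⇑(L.toAffineMap + AffineMap.const ℝ U v) = fun u => v + L u := by
    ext u
    simp [add_comm]
  rw [h2] at this
  rw [← this]
  have h3 : (L.toAffineMap + AffineMap.const ℝ U v).linear = L := by
    ext u
    simp
  rw [h3]
  exact (Submodule.equivMapOfInjective L hL _).finrank_eq

/-- The centroid of a compact convex set, computed in affine coordinates. -/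
theorem centroid_eq {U : Type*} [NormedAddCommGroup U] [NormedSpace ℝ U]
    [FiniteDimensional ℝ U] [MeasurableSpace U] [BorelSpace U] (μ : Measure U) [μ.IsAddHaarMeasure]
    (L : U →ₗ[ℝ] EuclideanSpace ℝ (Fin n)) (hL : Function.Injective L)
    (v : EuclideanSpace ℝ (Fin n)) {C : Set (EuclideanSpace ℝ (Fin n))} (hCc : IsCompact C)
    (hCv : Convex ℝ C) (hCn : C.Nonempty) (hC : C ⊆ Set.range fun u => v + L u)
    (hdim : finrank ℝ U = dim C) :
    IsCompact ((fun u => v + L u) ⁻¹' C) ∧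
    μ ((fun u => v + L u) ⁻¹' C) ≠ 0 ∧
    centroid C = v + L (⨍ u in (fun u => v + L u) ⁻¹' C, u ∂μ) := by
  set φ : U → EuclideanSpace ℝ (Fin n) := fun u => v + L u with hφ
  have hemb : Topology.IsClosedEmbedding φ :=
    (Homeomorph.addLeft v).isClosedEmbedding.comp
      (LinearMap.isClosedEmbedding_of_injective (LinearMap.ker_eq_bot.2 hL))
  have hmemb : MeasurableEmbedding φ := hemb.measurableEmbedding
  set S := φ ⁻¹' C with hS
  have himage : φ '' S = C := Set.image_preimage_eq_of_subset hC
  have hSc : IsCompact S := hemb.isCompact_preimage hCc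
  have hSv : Convex ℝ S := by
    intro x hx y hy a b ha hb hab
    have := hCv hx hy ha hb hab
    change φ (a • x + b • y) ∈ C
    convert this using 1
    simp only [hφ, map_add, map_smul, smul_add]
    nth_rewrite 1 [← one_smul ℝ v]
    rw [← hab, add_smul]
    abel
  have hSn : S.Nonempty := by
    rw [← himage] at hCn
    exact hCn.of_image
  have hSm : MeasurableSet S := hSc.measurableSet
  have hint : (interior S).Nonempty := by
    rw [hSv.interior_nonempty_iff_affineSpan_eq_top,
      AffineSubspace.affineSpan_eq_top_iff_vectorSpan_eq_top_of_nonempty _ _ _ hSn]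
    exact vectorSpan_preimage_eq_top L hL v hC hdim
  have hS0 : μ S ≠ 0 := (Measure.measure_pos_of_nonempty_interior μ hint).ne'
  have hStop : μ S ≠ ⊤ := hSc.measure_lt_top.ne
  refine ⟨hSc, hS0, ?_⟩
  obtain ⟨c, hc0, hctop, hc⟩ := exists_euclideanHausdorffMeasure_image μ L hL v
  have hrestr : (μHE[finrank ℝ U]).restrict C = c • (μ.restrict S).map φ := by
    ext t ht
    rw [Measure.restrict_apply ht, Measure.smul_apply, hmemb.map_apply,
      Measure.restrict_apply (hmemb.measurable ht), smul_eq_mul,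
      ← hc _ ((hmemb.measurable ht).inter hSm)]
    congr 1
    rw [Set.image_preimage_inter, himage]
  have hcr : c.toReal ≠ 0 := ENNReal.toReal_ne_zero.2 ⟨hc0, hctop⟩
  have hSint : IntegrableOn (fun u : U => u) S μ := continuous_id.continuousOn.integrableOn_compact hSc
  let L' : U →L[ℝ] EuclideanSpace ℝ (Fin n) := LinearMap.toContinuousLinearMap L
  have hSr : μ.real S ≠ 0 := ENNReal.toReal_ne_zero.2 ⟨hS0, hStop⟩
  rw [centroid, ← hdim, average_eq, hrestr, integral_smul_measure, hmemb.integral_map,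
    setAverage_eq]
  have h1 : (c • (μ.restrict S).map φ).real Set.univ = c.toReal * μ.real S := by
    simp [measureReal_def, Measure.map_apply hmemb.measurable MeasurableSet.univ]
  have h2 : ∫ u in S, φ u ∂μ = μ.real S • v + L (∫ u in S, u ∂μ) := by
    have hLi : IntegrableOn (fun u : U => L' u) S μ := L'.integrable_comp hSint
    have h3 : ∫ u in S, L' u ∂μ = L' (∫ u in S, u ∂μ) := L'.integral_comp_comm hSint
    change ∫ u in S, v + L' u ∂μ = _
    have hv : IntegrableOn (fun _ : U => v) S μ := integrableOn_const hStop
    rw [integral_add hv hLi, h3, setIntegral_const]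
    rfl
  rw [h1, h2, map_smul, smul_smul, smul_add, smul_smul]
  have e1 : (c.toReal * μ.real S)⁻¹ * c.toReal = (μ.real S)⁻¹ := by
    field_simp
  rw [e1, inv_mul_cancel₀ hSr, one_smul]

theorem centroid_eq_of_setIntegral_eq_zero {U : Type*} [NormedAddCommGroup U] [NormedSpace ℝ U]
    [FiniteDimensional ℝ U] [MeasurableSpace U] [BorelSpace U] (μ : Measure U) [μ.IsAddHaarMeasure]
    (L : U →ₗ[ℝ] EuclideanSpace ℝ (Fin n)) (hL : Function.Injective L)
    (v : EuclideanSpace ℝ (Fin n)) {C : Set (EuclideanSpace ℝ (Fin n))} (hCc : IsCompact C)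
    (hCv : Convex ℝ C) (hCn : C.Nonempty) (hC : C ⊆ Set.range fun u => v + L u)
    (hdim : finrank ℝ U = dim C) {w : U}
    (hw : ∫ u in (fun u => v + L u) ⁻¹' C, (u - w) ∂μ = 0) : centroid C = v + L w := by
  obtain ⟨h1, h2, h3⟩ := centroid_eq μ L hL v hCc hCv hCn hC hdim
  set S := (fun u => v + L u) ⁻¹' C
  have hStop : μ S ≠ ⊤ := h1.measure_lt_top.ne
  have hSr : μ.real S ≠ 0 := ENNReal.toReal_ne_zero.2 ⟨h2, hStop⟩
  have hu : IntegrableOn (fun u : U => u) S μ := continuous_id.continuousOn.integrableOn_compact h1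
  have hc : IntegrableOn (fun _ : U => w) S μ := integrableOn_const hStop
  rw [integral_sub hu hc, sub_eq_zero, setIntegral_const] at hw
  rw [h3, setAverage_eq, hw, smul_smul, inv_mul_cancel₀ hSr, one_smul]

theorem centroid_singleton (p : EuclideanSpace ℝ (Fin n)) : centroid {p} = p := by
  have h : dim ({p} : Set (EuclideanSpace ℝ (Fin n))) = 0 := by
    rw [dim, vectorSpan_singleton, finrank_bot]
  rw [centroid, h, Measure.euclideanHausdorffMeasure_zero, setAverage_eq]
  simp [measureReal_def]

theorem centroid_eq_zero_of_neg_mem {A : Set (EuclideanSpace ℝ (Fin n))}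
    (h : ∀ x ∈ A, -x ∈ A) : centroid A = 0 := by
  have hneg : A = -A := by
    ext x
    exact ⟨fun hx => h x hx, fun hx => by simpa using h _ hx⟩
  have hemb : MeasurableEmbedding (Neg.neg : EuclideanSpace ℝ (Fin n) → _) :=
    (Homeomorph.neg _).measurableEmbedding
  have hmap := (IsometryEquiv.neg (EuclideanSpace ℝ (Fin n))).measurePreserving_euclideanHausdorffMeasure
    (dim A)
  have h1 : ∫ x in A, x ∂μHE[dim A] = -∫ x in A, x ∂μHE[dim A] := by
    conv_lhs => rw [← hmap.map_eq]
    rw [← integral_neg]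
    change ∫ x in A, x ∂(Measure.map Neg.neg _) = _
    rw [hemb.setIntegral_map, Set.neg_preimage, ← hneg]
  have h2 : ∫ x in A, x ∂μHE[dim A] = 0 := by
    have : (2 : ℝ) • ∫ x in A, x ∂μHE[dim A] = 0 := by
      rw [two_smul]
      nth_rewrite 1 [h1]
      exact neg_add_cancel _
    exact (smul_eq_zero.1 this).resolve_left two_ne_zero
  rw [centroid, setAverage_eq, h2, smul_zero]

theorem eq_and_eq_of_add_eq_add {V : Type*} [AddCommGroup V] [Module ℝ V] {p q : Submodule ℝ V}
    (h : Disjoint p q) {x x' y y' : V} (hx : x ∈ p) (hx' : x' ∈ p) (hy : y ∈ q) (hy' : y' ∈ q)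
    (heq : x + y = x' + y') : x = x' ∧ y = y' := by
  have h1 : x - x' = y' - y := by
    rw [sub_eq_sub_iff_add_eq_add, heq, add_comm]
  have h2 : x - x' = 0 :=
    Submodule.disjoint_def.1 h _ (p.sub_mem hx hx') (h1 ▸ q.sub_mem hy' hy)
  exact ⟨sub_eq_zero.1 h2, (sub_eq_zero.1 (h1 ▸ h2)).symm⟩

/-- A set translated so that its centroid is the origin, inside its own direction space. -/
def centered (A : Set (EuclideanSpace ℝ (Fin n))) : Set (vectorSpan ℝ A) :=
  (fun u => centroid A + (vectorSpan ℝ A).subtype u) ⁻¹' A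

theorem mem_centered {A : Set (EuclideanSpace ℝ (Fin n))} {u : vectorSpan ℝ A} :
    u ∈ centered A ↔ centroid A + (u : EuclideanSpace ℝ (Fin n)) ∈ A := Iff.rfl

theorem subset_range_add_subtype {A : Set (EuclideanSpace ℝ (Fin n))}
    {v : EuclideanSpace ℝ (Fin n)} (hv : ∀ a ∈ A, a - v ∈ vectorSpan ℝ A) :
    A ⊆ Set.range fun u => v + (vectorSpan ℝ A).subtype u := fun a ha =>
  ⟨⟨a - v, hv a ha⟩, by simp⟩

theorem sub_centroid_mem {A : Set (EuclideanSpace ℝ (Fin n))} (hc : IsCompact A)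
    (hv : Convex ℝ A) {a : EuclideanSpace ℝ (Fin n)} (ha : a ∈ A) :
    a - centroid A ∈ vectorSpan ℝ A := by
  obtain ⟨-, -, h⟩ := centroid_eq (volume : Measure (vectorSpan ℝ A)) (vectorSpan ℝ A).subtype
    (vectorSpan ℝ A).injective_subtype a hc hv ⟨a, ha⟩
    (subset_range_add_subtype fun b hb => vsub_mem_vectorSpan ℝ hb ha) rfl
  rw [h, sub_add_cancel_left]
  exact Submodule.neg_mem _ (Subtype.coe_prop _)

theorem isCompact_centered {A : Set (EuclideanSpace ℝ (Fin n))} (hc : IsCompact A)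
    (hv : Convex ℝ A) (hn : A.Nonempty) : IsCompact (centered A) :=
  (centroid_eq (volume : Measure (vectorSpan ℝ A)) (vectorSpan ℝ A).subtype
    (vectorSpan ℝ A).injective_subtype (centroid A) hc hv hn
    (subset_range_add_subtype fun _ hb => sub_centroid_mem hc hv hb) rfl).1

theorem setIntegral_centered {A : Set (EuclideanSpace ℝ (Fin n))} (hc : IsCompact A)
    (hv : Convex ℝ A) (hn : A.Nonempty) : ∫ u in centered A, u = 0 := by
  obtain ⟨h1, h2, h3⟩ := centroid_eq (volume : Measure (vectorSpan ℝ A)) (vectorSpan ℝ A).subtype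
    (vectorSpan ℝ A).injective_subtype (centroid A) hc hv hn
    (subset_range_add_subtype fun _ hb => sub_centroid_mem hc hv hb) rfl
  have h4 := (vectorSpan ℝ A).injective_subtype
    ((left_eq_add.1 h3).trans (map_zero (vectorSpan ℝ A).subtype).symm)
  rw [setAverage_eq] at h4
  exact (smul_eq_zero.1 h4).resolve_left
    (inv_ne_zero (ENNReal.toReal_ne_zero.2 ⟨h2, h1.measure_lt_top.ne⟩))

theorem isAddHaarMeasure_volume_prod (E F : Type*) [NormedAddCommGroup E] [NormedSpace ℝ E]
    [FiniteDimensional ℝ E] [MeasureSpace E] [BorelSpace E]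
    [(volume : Measure E).IsAddHaarMeasure] [NormedAddCommGroup F] [NormedSpace ℝ F]
    [FiniteDimensional ℝ F] [MeasureSpace F] [BorelSpace F]
    [(volume : Measure F).IsAddHaarMeasure] : (volume : Measure (E × F)).IsAddHaarMeasure := by
  have := FiniteDimensional.proper ℝ E
  have := FiniteDimensional.proper ℝ F
  rw [Measure.volume_eq_prod]
  infer_instance

theorem setIntegral_prod_fst {E F : Type*} [NormedAddCommGroup E] [NormedSpace ℝ E]
    [CompleteSpace E]
    [MeasureSpace E] [BorelSpace E] [SecondCountableTopology E] [SFinite (volume : Measure E)]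
    [IsFiniteMeasureOnCompacts (volume : Measure E)]
    [NormedAddCommGroup F] [NormedSpace ℝ F] [MeasureSpace F] [BorelSpace F]
    [SecondCountableTopology F] [SFinite (volume : Measure F)]
    [IsFiniteMeasureOnCompacts (volume : Measure F)] {S : Set E} {T : Set F}
    (hS : IsCompact S) (hT : IsCompact T) (h : ∫ u in S, u = 0) :
    ∫ p in S ×ˢ T, p.1 = 0 := by
  rw [Measure.volume_eq_prod, setIntegral_prod]
  · simp only [setIntegral_const]
    rw [integral_smul, h, smul_zero]
  · exact continuous_fst.continuousOn.integrableOn_compact (hS.prod hT)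

theorem setIntegral_prod_snd {E F : Type*} [NormedAddCommGroup E] [NormedSpace ℝ E]
    [MeasureSpace E] [BorelSpace E] [SecondCountableTopology E] [SFinite (volume : Measure E)]
    [IsFiniteMeasureOnCompacts (volume : Measure E)]
    [NormedAddCommGroup F] [NormedSpace ℝ F] [MeasureSpace F] [BorelSpace F]
    [SecondCountableTopology F] [SFinite (volume : Measure F)]
    [IsFiniteMeasureOnCompacts (volume : Measure F)] {S : Set E} {T : Set F}
    (hS : IsCompact S) (hT : IsCompact T) (h : ∫ u in T, u = 0) :
    ∫ p in S ×ˢ T, p.2 = 0 := by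
  rw [Measure.volume_eq_prod, setIntegral_prod]
  · simp only [h, integral_zero]
  · exact continuous_snd.continuousOn.integrableOn_compact (hS.prod hT)

/-- The centroid of the Minkowski sum of two sets in independent directions. -/
theorem centroid_add {A B : Set (EuclideanSpace ℝ (Fin n))} (hAc : IsCompact A)
    (hAv : Convex ℝ A) (hAn : A.Nonempty) (hBc : IsCompact B) (hBv : Convex ℝ B)
    (hBn : B.Nonempty) (h : Disjoint (vectorSpan ℝ A) (vectorSpan ℝ B)) :
    centroid (A + B) = centroid A + centroid B := by
  have := isAddHaarMeasure_volume_prod (vectorSpan ℝ A) (vectorSpan ℝ B)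
  set L := (vectorSpan ℝ A).subtype.coprod (vectorSpan ℝ B).subtype
  have hLapp : ∀ p, L p = (p.1 : EuclideanSpace ℝ (Fin n)) + p.2 := fun p => rfl
  have hL : Function.Injective L := by
    intro p q hpq
    obtain ⟨h1, h2⟩ := eq_and_eq_of_add_eq_add h p.1.2 q.1.2 p.2.2 q.2.2 hpq
    exact Prod.ext (Subtype.ext h1) (Subtype.ext h2)
  have hrange : A + B ⊆ Set.range fun p => centroid A + centroid B + L p := by
    rintro _ ⟨a, ha, b, hb, rfl⟩
    refine ⟨(⟨_, sub_centroid_mem hAc hAv ha⟩, ⟨_, sub_centroid_mem hBc hBv hb⟩), ?_⟩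
    dsimp only
    rw [hLapp]
    dsimp only
    abel
  have hpre : (fun p => centroid A + centroid B + L p) ⁻¹' (A + B) =
      centered A ×ˢ centered B := by
    ext p
    rw [Set.mem_prod, mem_centered, mem_centered]
    constructor
    · rintro ⟨a, ha, b, hb, hab⟩
      obtain ⟨h1, h2⟩ := eq_and_eq_of_add_eq_add h (sub_centroid_mem hAc hAv ha) p.1.2
        (sub_centroid_mem hBc hBv hb) p.2.2 (by
          dsimp only at hab
          rw [hLapp] at hab
          rw [sub_add_sub_comm, hab]
          abel)
      rw [← h1, ← h2, add_sub_cancel, add_sub_cancel]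
      exact ⟨ha, hb⟩
    · rintro ⟨h1, h2⟩
      refine ⟨_, h1, _, h2, ?_⟩
      dsimp only
      rw [hLapp]
      abel
  have hcA := isCompact_centered hAc hAv hAn
  have hcB := isCompact_centered hBc hBv hBn
  have key := centroid_eq_of_setIntegral_eq_zero
    (volume : Measure (vectorSpan ℝ A × vectorSpan ℝ B)) L hL (centroid A + centroid B)
    (hAc.add hBc) (hAv.add hBv) (hAn.add hBn) hrange
    (by rw [dim_add hAn hBn h, finrank_prod]; rfl) (w := 0) ?_
  · rw [key, map_zero, add_zero]
  · rw [hpre]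
    simp only [sub_zero]
    have hint : IntegrableOn (fun p : vectorSpan ℝ A × vectorSpan ℝ B => p)
        (centered A ×ˢ centered B) :=
      continuous_id.continuousOn.integrableOn_compact (hcA.prod hcB)
    apply Prod.ext
    · rw [fst_integral hint]
      exact setIntegral_prod_fst hcA hcB (setIntegral_centered hAc hAv hAn)
    · rw [snd_integral hint]
      exact setIntegral_prod_snd hcA hcB (setIntegral_centered hBc hBv hBn)

/-- Integration over a set described by its slices. -/
theorem setIntegral_eq_integral_slices {X E : Type*} [MeasureSpace X]
    [SFinite (volume : Measure X)] [NormedAddCommGroup E] [NormedSpace ℝ E] {K : Set (ℝ × X)}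
    (hK : MeasurableSet K) {f : ℝ × X → E} (hf : IntegrableOn f K) {I : Set ℝ}
    (hI : MeasurableSet I) {k : ℝ → Set X} (hmem : ∀ t x, (t, x) ∈ K ↔ t ∈ I ∧ x ∈ k t) :
    ∫ p in K, f p = ∫ t in I, ∫ x in k t, f (t, x) := by
  rw [← integral_indicator hK, Measure.volume_eq_prod, integral_prod, ← integral_indicator hI]
  · congr 1
    ext t
    by_cases ht : t ∈ I
    · rw [Set.indicator_of_mem ht]
      have hk : k t = Prod.mk t ⁻¹' K := by
        ext x
        simp [hmem, ht]
      rw [← integral_indicator (hk ▸ measurable_prodMk_left hK)]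
      congr 1
      ext x
      by_cases hx : x ∈ k t
      · rw [Set.indicator_of_mem hx, Set.indicator_of_mem ((hmem t x).2 ⟨ht, hx⟩)]
      · rw [Set.indicator_of_notMem hx, Set.indicator_of_notMem fun h => hx ((hmem t x).1 h).2]
    · rw [Set.indicator_of_notMem ht]
      have : ∀ x, K.indicator f (t, x) = 0 := fun x =>
        Set.indicator_of_notMem (fun h => ht ((hmem t x).1 h).1) _
      simp only [this, integral_zero]
  · rw [← Measure.volume_eq_prod]
    exact hf.integrable_indicator hK

theorem setIntegral_smul_eq_zero {E : Type*} [NormedAddCommGroup E] [NormedSpace ℝ E]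
    [FiniteDimensional ℝ E] [MeasureSpace E] [BorelSpace E]
    [(volume : Measure E).IsAddHaarMeasure] {S : Set E} (h : ∫ u in S, u = 0) {r : ℝ}
    (hr : 0 ≤ r) : ∫ u in r • S, u = 0 := by
  rcases hr.eq_or_lt with rfl | hr
  · refine setIntegral_eq_zero_of_forall_eq_zero ?_
    rintro _ ⟨x, -, rfl⟩
    simp
  · have := Measure.setIntegral_comp_smul_of_pos volume (fun u : E => u) S hr
    rw [integral_smul, h, smul_zero] at this
    exact (smul_eq_zero.1 this.symm).resolve_left (by positivity)

theorem integral_beta_moment (i j : ℕ) :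
    ∫ t in Set.Icc (0 : ℝ) 1, ((1 - t) ^ i * t ^ j) * (t - (j + 1) / (i + j + 2)) = 0 := by
  rw [integral_Icc_eq_integral_Ioc, ← intervalIntegral.integral_of_le zero_le_one]
  have hd : ∀ t ∈ Set.uIcc (0 : ℝ) 1,
      HasDerivAt (fun t : ℝ => -((1 - t) ^ (i + 1) * t ^ (j + 1)) / (i + j + 2))
        (((1 - t) ^ i * t ^ j) * (t - (j + 1) / (i + j + 2))) t := by
    intro t _
    have h1 : HasDerivAt (fun t : ℝ => (1 - t) ^ (i + 1)) _ t :=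
      ((hasDerivAt_id t).const_sub 1).pow (i + 1)
    have h2 : HasDerivAt (fun t : ℝ => t ^ (j + 1)) _ t := (hasDerivAt_id t).pow (j + 1)
    refine ((h1.mul h2).neg.div_const ((i : ℝ) + j + 2)).congr_deriv ?_
    have : (i : ℝ) + j + 2 ≠ 0 := by positivity
    field_simp
    simp only [id, Nat.add_sub_cancel]
    push_cast
    ring
  rw [intervalIntegral.integral_eq_sub_of_hasDerivAt hd
    (Continuous.intervalIntegrable (by fun_prop) _ _)]
  simp

/-- The centroid of the join of two nonempty sets in independent directions. -/
theorem centroid_convexHull_union {A B : Set (EuclideanSpace ℝ (Fin n))} (hAc : IsCompact A)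
    (hAv : Convex ℝ A) (hAn : A.Nonempty) (hBc : IsCompact B) (hBv : Convex ℝ B)
    (hBn : B.Nonempty) (h : Disjoint (Submodule.span ℝ A) (Submodule.span ℝ B))
    {l : EuclideanSpace ℝ (Fin n) →ₗ[ℝ] ℝ} (hlA : ∀ x ∈ A, l x = 1) (hlB : ∀ x ∈ B, l x = 1) :
    centroid (convexHull ℝ (A ∪ B)) = centroid A +
      (((dim B : ℝ) + 1) / (dim A + dim B + 2)) • (centroid B - centroid A) := by
  have := isAddHaarMeasure_volume_prod (vectorSpan ℝ A) (vectorSpan ℝ B)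
  have := isAddHaarMeasure_volume_prod ℝ (vectorSpan ℝ A × vectorSpan ℝ B)
  have hcspan : ∀ {X : Set (EuclideanSpace ℝ (Fin n))}, IsCompact X → Convex ℝ X → X.Nonempty →
      centroid X ∈ Submodule.span ℝ X := by
    rintro X hc hv ⟨x, hx⟩
    rw [← sub_sub_cancel x (centroid X)]
    exact Submodule.sub_mem _ (Submodule.subset_span hx)
      (vectorSpan_le_span X (sub_centroid_mem hc hv hx))
  have hlc : ∀ {X : Set (EuclideanSpace ℝ (Fin n))}, IsCompact X → Convex ℝ X → X.Nonempty →
      (∀ x ∈ X, l x = 1) → l (centroid X) = 1 := by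
    rintro X hc hv ⟨x, hx⟩ hl
    have := eq_zero_of_mem_vectorSpan hl (sub_centroid_mem hc hv hx)
    rw [map_sub, hl x hx] at this
    linarith
  have hcA := hcspan hAc hAv hAn
  have hcB := hcspan hBc hBv hBn
  set L : ℝ × (vectorSpan ℝ A × vectorSpan ℝ B) →ₗ[ℝ] EuclideanSpace ℝ (Fin n) :=
    (LinearMap.toSpanSingleton ℝ _ (centroid B - centroid A)).coprod
      ((vectorSpan ℝ A).subtype.coprod (vectorSpan ℝ B).subtype)
  have hLapp : ∀ p, L p = p.1 • (centroid B - centroid A) +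
    ((p.2.1 : EuclideanSpace ℝ (Fin n)) + p.2.2) := fun p => rfl
  have hL : Function.Injective L := by
    rw [injective_iff_map_eq_zero]
    rintro ⟨t, u, w⟩ hp
    rw [hLapp] at hp
    dsimp only at hp
    obtain ⟨h1, h2⟩ := eq_and_eq_of_add_eq_add h
      (Submodule.sub_mem _ (vectorSpan_le_span A u.2) (Submodule.smul_mem _ t hcA))
      (Submodule.zero_mem _)
      (Submodule.add_mem _ (vectorSpan_le_span B w.2) (Submodule.smul_mem _ t hcB))
      (Submodule.zero_mem _) (by
        rw [add_zero, ← hp, smul_sub]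
        abel)
    have ht : t = 0 := by
      have := congrArg l h1
      rw [map_sub, eq_zero_of_mem_vectorSpan hlA u.2, map_smul, hlc hAc hAv hAn hlA] at this
      simpa using this
    subst ht
    rw [zero_smul, sub_zero] at h1
    rw [zero_smul, add_zero] at h2
    exact Prod.ext rfl (Prod.ext (Subtype.ext h1) (Subtype.ext h2))
  have hmemeq : ∀ t : ℝ, ∀ u : vectorSpan ℝ A, ∀ w : vectorSpan ℝ B,
      centroid A + L (t, (1 - t) • u, t • w) =
        (1 - t) • (centroid A + (u : EuclideanSpace ℝ (Fin n))) +
          t • (centroid B + (w : EuclideanSpace ℝ (Fin n))) := by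
    intro t u w
    rw [hLapp]
    simp only [Submodule.coe_smul]
    module
  have hCc := isCompact_convexHull_union hAc hBc hAv hBv
  have hCn : (convexHull ℝ (A ∪ B)).Nonempty := (hAn.inl).convexHull
  have hlC : ∀ x ∈ convexHull ℝ (A ∪ B), l x = 1 := by
    intro x hx
    obtain ⟨t, -, -, a, ha, b, hb, rfl⟩ := (mem_convexHull_union_iff hAv hBv hAn hBn).1 hx
    rw [map_add, map_smul, map_smul, hlA a ha, hlB b hb]
    simp
  have hrange : convexHull ℝ (A ∪ B) ⊆ Set.range fun p => centroid A + L p := by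
    intro x hx
    obtain ⟨t, -, -, a, ha, b, hb, rfl⟩ := (mem_convexHull_union_iff hAv hBv hAn hBn).1 hx
    refine ⟨(t, (1 - t) • ⟨_, sub_centroid_mem hAc hAv ha⟩,
      t • ⟨_, sub_centroid_mem hBc hBv hb⟩), ?_⟩
    dsimp only
    rw [hmemeq, add_sub_cancel, add_sub_cancel]
  have hmem : ∀ t x, (t, x) ∈ (fun p => centroid A + L p) ⁻¹' (convexHull ℝ (A ∪ B)) ↔
      t ∈ Set.Icc (0 : ℝ) 1 ∧ x ∈ ((1 - t) • centered A) ×ˢ (t • centered B) := by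
    rintro t ⟨u, w⟩
    rw [Set.mem_preimage, mem_convexHull_union_iff hAv hBv hAn hBn]
    constructor
    · rintro ⟨s, h0, h1, a, ha, b, hb, hab⟩
      have e1 := hmemeq s ⟨_, sub_centroid_mem hAc hAv ha⟩ ⟨_, sub_centroid_mem hBc hBv hb⟩
      rw [add_sub_cancel, add_sub_cancel, ← hab] at e1
      have e2 := hL (add_left_cancel e1)
      simp only [Prod.mk.injEq] at e2
      obtain ⟨rfl, rfl, rfl⟩ := e2
      refine ⟨⟨h0, h1⟩, Set.smul_mem_smul_set ?_, Set.smul_mem_smul_set ?_⟩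
      · rw [mem_centered, add_sub_cancel]
        exact ha
      · rw [mem_centered, add_sub_cancel]
        exact hb
    · rintro ⟨⟨h0, h1⟩, ⟨u, hu, rfl⟩, ⟨w, hw, rfl⟩⟩
      exact ⟨t, h0, h1, _, hu, _, hw, hmemeq t u w⟩
  have hdim : finrank ℝ (ℝ × (vectorSpan ℝ A × vectorSpan ℝ B)) =
      dim (convexHull ℝ (A ∪ B)) := by
    have e1 := spanRank_eq_dim_add_one hlC hCn
    have e2 := spanRank_eq_dim_add_one hlA hAn
    have e3 := spanRank_eq_dim_add_one hlB hBn
    rw [spanRank_convexHull_union h] at e1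
    rw [finrank_prod, finrank_prod, finrank_self]
    change 1 + (dim A + dim B) = _
    omega
  have hSc := isCompact_centered hAc hAv hAn
  have hTc := isCompact_centered hBc hBv hBn
  have hS0 := setIntegral_centered hAc hAv hAn
  have hT0 := setIntegral_centered hBc hBv hBn
  set τ : ℝ := ((dim B : ℝ) + 1) / (dim A + dim B + 2) with hτ
  have hKc := (centroid_eq (volume : Measure (ℝ × (vectorSpan ℝ A × vectorSpan ℝ B))) L hL
    (centroid A) hCc (convex_convexHull ℝ _) hCn hrange hdim).1
  have key := centroid_eq_of_setIntegral_eq_zero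
    (volume : Measure (ℝ × (vectorSpan ℝ A × vectorSpan ℝ B))) L hL (centroid A)
    hCc (convex_convexHull ℝ _) hCn hrange hdim (w := (τ, 0, 0)) ?_
  · rw [key, hLapp]
    simp
  set K := (fun p => centroid A + L p) ⁻¹' (convexHull ℝ (A ∪ B)) with hK
  have hKm : MeasurableSet K := hKc.measurableSet
  have hint : ∀ {E : Type} [NormedAddCommGroup E] (f : ℝ × (vectorSpan ℝ A × vectorSpan ℝ B) → E),
      Continuous f → IntegrableOn f K := fun f hf => hf.continuousOn.integrableOn_compact hKc
  have hi1 := hint (fun p => p - (τ, 0, 0)) (by fun_prop)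
  have hi2 := hint (fun p => p.2 - (0, 0)) (by fun_prop)
  apply Prod.ext
  · rw [fst_integral hi1]
    simp only [Prod.fst_sub, Prod.fst_zero]
    rw [setIntegral_eq_integral_slices hKm (hint (fun p => p.1 - τ) (by fun_prop))
      measurableSet_Icc hmem]
    simp only [setIntegral_const]
    have hvol : ∀ t ∈ Set.Icc (0 : ℝ) 1,
        volume.real (((1 - t) • centered A) ×ˢ (t • centered B)) • (t - τ) =
          (volume.real (centered A) * volume.real (centered B)) *
            (((1 - t) ^ dim A * t ^ dim B) * (t - τ)) := by
      rintro t ⟨h0, h1⟩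
      have ha : 0 ≤ (1 - t) ^ dim A := pow_nonneg (by linarith) _
      have hb : 0 ≤ t ^ dim B := pow_nonneg h0 _
      have va : volume.real ((1 - t) • centered A) = (1 - t) ^ dim A * volume.real (centered A) := by
        rw [measureReal_def, Measure.addHaar_smul, ENNReal.toReal_mul,
          ENNReal.toReal_ofReal (abs_nonneg _)]
        change |(1 - t) ^ dim A| * _ = _
        rw [abs_of_nonneg ha]
        rfl
      have vb : volume.real (t • centered B) = t ^ dim B * volume.real (centered B) := by
        rw [measureReal_def, Measure.addHaar_smul, ENNReal.toReal_mul,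
          ENNReal.toReal_ofReal (abs_nonneg _)]
        change |t ^ dim B| * _ = _
        rw [abs_of_nonneg hb]
        rfl
      rw [Measure.volume_eq_prod, measureReal_prod_prod, va, vb, smul_eq_mul]
      ring
    rw [setIntegral_congr_fun measurableSet_Icc hvol, integral_const_mul, hτ,
      integral_beta_moment, mul_zero]
  · rw [snd_integral hi1]
    simp only [Prod.snd_sub, Prod.snd_zero]
    apply Prod.ext
    · rw [fst_integral hi2]
      simp only [Prod.fst_sub, Prod.fst_zero, sub_zero]
      rw [setIntegral_eq_integral_slices hKm (hint (fun p => p.2.1) (by fun_prop))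
        measurableSet_Icc hmem]
      refine setIntegral_eq_zero_of_forall_eq_zero fun t ht => ?_
      exact setIntegral_prod_fst (hSc.smul _) (hTc.smul _)
        (setIntegral_smul_eq_zero hS0 (sub_nonneg.2 ht.2))
    · rw [snd_integral hi2]
      simp only [Prod.snd_sub, Prod.snd_zero, sub_zero]
      rw [setIntegral_eq_integral_slices hKm (hint (fun p => p.2.2) (by fun_prop))
        measurableSet_Icc hmem]
      refine setIntegral_eq_zero_of_forall_eq_zero fun t ht => ?_
      exact setIntegral_prod_snd (hSc.smul _) (hTc.smul _)
        (setIntegral_smul_eq_zero hT0 ht.1)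

/-- Weighted additivity of the centroid under joins, the empty set included. -/
theorem spanRank_smul_centroid_convexHull_union {A B : Set (EuclideanSpace ℝ (Fin n))}
    (hAc : IsCompact A) (hAv : Convex ℝ A) (hBc : IsCompact B) (hBv : Convex ℝ B)
    (h : Disjoint (Submodule.span ℝ A) (Submodule.span ℝ B))
    {l : EuclideanSpace ℝ (Fin n) →ₗ[ℝ] ℝ} (hlA : ∀ x ∈ A, l x = 1) (hlB : ∀ x ∈ B, l x = 1) :
    (spanRank (convexHull ℝ (A ∪ B)) : ℝ) • centroid (convexHull ℝ (A ∪ B)) =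
      (spanRank A : ℝ) • centroid A + (spanRank B : ℝ) • centroid B := by
  rcases A.eq_empty_or_nonempty with rfl | hAn
  · rw [Set.empty_union, hBv.convexHull_eq, spanRank_empty, Nat.cast_zero, zero_smul, zero_add]
  rcases B.eq_empty_or_nonempty with rfl | hBn
  · rw [Set.union_empty, hAv.convexHull_eq, spanRank_empty, Nat.cast_zero, zero_smul, add_zero]
  rw [centroid_convexHull_union hAc hAv hAn hBc hBv hBn h hlA hlB, spanRank_convexHull_union h,
    spanRank_eq_dim_add_one hlA hAn, spanRank_eq_dim_add_one hlB hBn]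
  have h0 : (dim A : ℝ) + dim B + 2 ≠ 0 := by positivity
  push_cast
  rw [smul_add, smul_smul]
  have e : ((dim A : ℝ) + 1 + (dim B + 1)) * ((dim B + 1) / (dim A + dim B + 2)) = dim B + 1 := by
    field_simp
    ring
  rw [e]
  module

section FacesOfSums

variable {V : Type*} [AddCommGroup V] [Module ℝ V]

theorem l1Sum_face {A B : Set V} (hA : Convex ℝ A) (hB : Convex ℝ B) (hAn : A.Nonempty)
    (hBn : B.Nonempty) {X : Set V} (hX : X ∈ properFaces (l1Sum A B)) :
    ∃ l : V →ₗ[ℝ] ℝ, (∀ x ∈ A, l x ≤ 1) ∧ (∀ x ∈ B, l x ≤ 1) ∧ X ∩ A = {x ∈ A | l x = 1} ∧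
      X ∩ B = {x ∈ B | l x = 1} ∧ X = convexHull ℝ ((X ∩ A) ∪ (X ∩ B)) := by
  obtain ⟨l, hl, hXe⟩ := hX
  have hAs : A ⊆ l1Sum A B := Set.subset_union_left.trans (subset_convexHull ℝ _)
  have hBs : B ⊆ l1Sum A B := Set.subset_union_right.trans (subset_convexHull ℝ _)
  have hXA : X ∩ A = {x ∈ A | l x = 1} := by
    ext x
    rw [hXe]
    exact ⟨fun h => ⟨h.2, h.1.2⟩, fun h => ⟨⟨hAs h.1, h.2⟩, h.1⟩⟩
  have hXB : X ∩ B = {x ∈ B | l x = 1} := by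
    ext x
    rw [hXe]
    exact ⟨fun h => ⟨h.2, h.1.2⟩, fun h => ⟨⟨hBs h.1, h.2⟩, h.1⟩⟩
  refine ⟨l, fun x hx => hl x (hAs hx), fun x hx => hl x (hBs hx), hXA, hXB, ?_⟩
  apply Set.Subset.antisymm
  · intro x hx
    have hx' := hx
    rw [hXe] at hx
    obtain ⟨hx1, hx2⟩ := hx
    obtain ⟨t, h0, h1, a, ha, b, hb, rfl⟩ := (mem_convexHull_union_iff hA hB hAn hBn).1 hx1
    have la := hl a (hAs ha)
    have lb := hl b (hBs hb)
    rw [map_add, map_smul, map_smul, smul_eq_mul, smul_eq_mul] at hx2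
    rcases h0.eq_or_lt with rfl | h0
    · simp only [sub_zero, one_smul, zero_smul, add_zero] at hx' ⊢
      exact subset_convexHull ℝ _ (Or.inl ⟨hx', ha⟩)
    rcases h1.eq_or_lt with rfl | h1
    · simp only [sub_self, one_smul, zero_smul, zero_add] at hx' ⊢
      exact subset_convexHull ℝ _ (Or.inr ⟨hx', hb⟩)
    have la' : l a = 1 := by nlinarith
    have lb' : l b = 1 := by nlinarith
    have hpa : a ∈ convexHull ℝ ((X ∩ A) ∪ (X ∩ B)) :=
      subset_convexHull ℝ _ (Or.inl (hXA ▸ ⟨ha, la'⟩))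
    have hpb : b ∈ convexHull ℝ ((X ∩ A) ∪ (X ∩ B)) :=
      subset_convexHull ℝ _ (Or.inr (hXB ▸ ⟨hb, lb'⟩))
    exact convex_convexHull ℝ _ hpa hpb (sub_nonneg.2 h1.le) h0.le (by ring)
  · have hXc : Convex ℝ X := by
      rw [hXe]
      exact (convex_convexHull ℝ _).inter (convex_hyperplane l.isLinear 1)
    exact convexHull_min (Set.union_subset Set.inter_subset_left Set.inter_subset_left) hXc

/-- The component in `A` of a subset of `A + B`. -/
def sumPart {W : Type*} [AddCommGroup W] (A B X : Set W) : Set W := {x ∈ A | ∃ y ∈ B, x + y ∈ X}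

theorem sumPart_mono {W : Type*} [AddCommGroup W] (A B : Set W) {X Y : Set W} (h : X ⊆ Y) :
    sumPart A B X ⊆ sumPart A B Y :=
  fun _ ⟨hx, y, hy, hxy⟩ => ⟨hx, y, hy, h hxy⟩

theorem sumPart_mem_closedFaces {A B X : Set V} (hX : X ∈ closedFaces (A + B)) :
    sumPart A B X ∈ closedFaces A := by
  obtain ⟨l, c, hl, hXe, hXn⟩ := hX
  obtain ⟨x₀, hx₀⟩ := hXn
  rw [hXe] at hx₀
  obtain ⟨⟨a₀, ha₀, b₀, hb₀, rfl⟩, hc⟩ := hx₀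
  dsimp only at hc
  rw [map_add] at hc
  have hA : ∀ x ∈ A, l x ≤ l a₀ := fun x hx => by
    have := hl _ (Set.add_mem_add hx hb₀)
    rw [map_add] at this
    linarith
  have hB : ∀ x ∈ B, l x ≤ l b₀ := fun x hx => by
    have := hl _ (Set.add_mem_add ha₀ hx)
    rw [map_add] at this
    linarith
  have heq : sumPart A B X = {x ∈ A | l x = l a₀} := by
    ext x
    constructor
    · rintro ⟨hx, y, hy, hxy⟩
      rw [hXe] at hxy
      refine ⟨hx, ?_⟩
      have h1 := hxy.2
      rw [map_add] at h1
      have h2 := hA x hx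
      have h3 := hB y hy
      linarith
    · rintro ⟨hx, hlx⟩
      refine ⟨hx, b₀, hb₀, ?_⟩
      rw [hXe]
      exact ⟨Set.add_mem_add hx hb₀, by rw [map_add, hlx, hc]⟩
  exact ⟨l, l a₀, hA, heq, a₀, heq ▸ ⟨ha₀, rfl⟩⟩

theorem eq_sumPart_add_sumPart {A B X : Set V} (hX : X ∈ closedFaces (A + B)) :
    X = sumPart A B X + sumPart B A X := by
  obtain ⟨l, c, hl, hXe, -⟩ := hX
  apply Set.Subset.antisymm
  · intro x hx
    have hx' := hx
    rw [hXe] at hx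
    obtain ⟨⟨a, ha, b, hb, rfl⟩, -⟩ := hx
    exact Set.add_mem_add ⟨ha, b, hb, hx'⟩ ⟨hb, a, ha, by rwa [add_comm]⟩
  · rintro _ ⟨a, ⟨ha, b', hb', hab'⟩, b, ⟨hb, a', ha', hba'⟩, rfl⟩
    rw [hXe] at hab' hba' ⊢
    have h1 := hab'.2
    have h2 := hba'.2
    have h3 := hl _ (Set.add_mem_add ha hb)
    have h4 := hl _ (Set.add_mem_add ha' hb')
    refine ⟨Set.add_mem_add ha hb, ?_⟩
    simp only [map_add] at h1 h2 h3 h4 ⊢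
    linarith

theorem span_add_of_zero_mem {A B : Set V} (hA : (0 : V) ∈ A) (hB : (0 : V) ∈ B) :
    Submodule.span ℝ (A + B) = Submodule.span ℝ A ⊔ Submodule.span ℝ B := by
  rw [← vectorSpan_eq_span hA, ← vectorSpan_eq_span hB, ← vectorSpan_add ⟨0, hA⟩ ⟨0, hB⟩,
    vectorSpan_eq_span]
  exact ⟨0, hA, 0, hB, add_zero 0⟩

end FacesOfSums

theorem isCompact_of_eq_hyperplane_section {V : Type*} [NormedAddCommGroup V] [NormedSpace ℝ V]
    [FiniteDimensional ℝ V] {A X : Set V} (hA : IsCompact A) {l : V →ₗ[ℝ] ℝ} {c : ℝ}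
    (hX : X = {x ∈ A | l x = c}) : IsCompact X := by
  rw [hX]
  exact hA.inter_right (isClosed_singleton.preimage l.continuous_of_finiteDimensional)

theorem convex_of_eq_hyperplane_section {V : Type*} [AddCommGroup V] [Module ℝ V] {A X : Set V}
    (hA : Convex ℝ A) {l : V →ₗ[ℝ] ℝ} {c : ℝ} (hX : X = {x ∈ A | l x = c}) : Convex ℝ X := by
  rw [hX]
  exact hA.inter (convex_hyperplane l.isLinear c)

/-- A compact convex set symmetric about the origin. -/
structure IsSymmetricConvex {V : Type*} [NormedAddCommGroup V] [NormedSpace ℝ V]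
    (A : Set V) : Prop where
  isCompact : IsCompact A
  convex : Convex ℝ A
  zero_mem : (0 : V) ∈ A
  neg_mem : ∀ x ∈ A, -x ∈ A

theorem IsSymmetricConvex.l1Sum {V : Type*} [NormedAddCommGroup V] [NormedSpace ℝ V]
    {A B : Set V} (hA : IsSymmetricConvex A) (hB : IsSymmetricConvex B) :
    IsSymmetricConvex (l1Sum A B) where
  isCompact := isCompact_convexHull_union hA.isCompact hB.isCompact hA.convex hB.convex
  convex := convex_convexHull ℝ _
  zero_mem := subset_convexHull ℝ _ (Or.inl hA.zero_mem)
  neg_mem x hx := by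
    obtain ⟨t, h0, h1, a, ha, b, hb, rfl⟩ := (mem_convexHull_union_iff hA.convex hB.convex
      ⟨0, hA.zero_mem⟩ ⟨0, hB.zero_mem⟩).1 hx
    refine (mem_convexHull_union_iff hA.convex hB.convex
      ⟨0, hA.zero_mem⟩ ⟨0, hB.zero_mem⟩).2 ⟨t, h0, h1, -a, hA.neg_mem a ha, -b, hB.neg_mem b hb, ?_⟩
    module

theorem IsSymmetricConvex.add {V : Type*} [NormedAddCommGroup V] [NormedSpace ℝ V]
    {A B : Set V} (hA : IsSymmetricConvex A) (hB : IsSymmetricConvex B) :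
    IsSymmetricConvex (A + B) where
  isCompact := hA.isCompact.add hB.isCompact
  convex := hA.convex.add hB.convex
  zero_mem := ⟨0, hA.zero_mem, 0, hB.zero_mem, add_zero 0⟩
  neg_mem := by
    rintro _ ⟨a, ha, b, hb, rfl⟩
    exact ⟨-a, hA.neg_mem a ha, -b, hB.neg_mem b hb, (neg_add a b).symm⟩

theorem mem_segment_neg_iff {V : Type*} [AddCommGroup V] [Module ℝ V] {v x : V} :
    x ∈ segment ℝ (-v) v ↔ ∃ t : ℝ, -1 ≤ t ∧ t ≤ 1 ∧ x = t • v := by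
  constructor
  · rintro ⟨a, b, ha, hb, hab, rfl⟩
    refine ⟨b - a, by linarith, by linarith, ?_⟩
    module
  · rintro ⟨t, h0, h1, rfl⟩
    refine ⟨(1 - t) / 2, (1 + t) / 2, by linarith, by linarith, by ring, ?_⟩
    module

theorem isSymmetricConvex_segment {V : Type*} [NormedAddCommGroup V] [NormedSpace ℝ V] (v : V) :
    IsSymmetricConvex (segment ℝ (-v) v) where
  isCompact := by
    rw [← convexHull_pair]
    exact (Set.toFinite _).isCompact_convexHull ℝ
  convex := convex_segment _ _
  zero_mem := mem_segment_neg_iff.2 ⟨0, by simp⟩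
  neg_mem x hx := by
    obtain ⟨t, h0, h1, rfl⟩ := mem_segment_neg_iff.1 hx
    exact mem_segment_neg_iff.2 ⟨-t, by linarith, by linarith, by simp⟩

theorem IsHanner.isSymmetricConvex {V : Type*} [NormedAddCommGroup V] [NormedSpace ℝ V]
    {A : Set V} (h : IsHanner A) : IsSymmetricConvex A := by
  induction h with
  | interval v hv => exact isSymmetricConvex_segment v
  | l1 A B _ _ _ hA hB => exact hA.l1Sum hB
  | lInfty A B _ _ _ hA hB => exact hA.add hB

theorem span_segment_neg {V : Type*} [AddCommGroup V] [Module ℝ V] (v : V) :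
    Submodule.span ℝ (segment ℝ (-v) v) = Submodule.span ℝ {v} := by
  apply le_antisymm
  · rw [Submodule.span_le]
    intro x hx
    obtain ⟨t, -, -, rfl⟩ := mem_segment_neg_iff.1 hx
    exact Submodule.smul_mem _ t (Submodule.mem_span_singleton_self v)
  · exact Submodule.span_mono (Set.singleton_subset_iff.2 (right_mem_segment ℝ (-v) v))

theorem properFace_segment {V : Type*} [AddCommGroup V] [Module ℝ V] {v : V} {X : Set V}
    (hX : X ∈ properFaces (segment ℝ (-v) v)) (hn : X.Nonempty) : X = {v} ∨ X = {-v} := by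
  obtain ⟨l, hl, rfl⟩ := hX
  obtain ⟨x, hx, hlx⟩ := hn
  obtain ⟨t, h0, h1, rfl⟩ := mem_segment_neg_iff.1 hx
  have l1 := hl v (right_mem_segment ℝ (-v) v)
  have l2 := hl (-v) (left_mem_segment ℝ (-v) v)
  rw [map_neg] at l2
  rw [map_smul, smul_eq_mul] at hlx
  rcases le_total 0 t with ht | ht
  · have hv : l v = 1 := by nlinarith
    left
    ext y
    constructor
    · rintro ⟨hy, hly⟩
      obtain ⟨s, -, -, rfl⟩ := mem_segment_neg_iff.1 hy
      rw [map_smul, hv, smul_eq_mul, mul_one] at hly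
      simp [hly]
    · rintro rfl
      exact ⟨right_mem_segment ℝ _ _, hv⟩
  · have hv : l v = -1 := by nlinarith
    right
    ext y
    constructor
    · rintro ⟨hy, hly⟩
      obtain ⟨s, -, -, rfl⟩ := mem_segment_neg_iff.1 hy
      rw [map_smul, hv, smul_eq_mul] at hly
      have : s = -1 := by linarith
      simp [this]
    · rintro rfl
      exact ⟨left_mem_segment ℝ _ _, by rw [map_neg, hv, neg_neg]⟩

theorem flagInvariant_segment {v : EuclideanSpace ℝ (Fin n)} (hv : v ≠ 0) :
    FlagInvariant centroid (segment ℝ (-v) v) := by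
  have h1 : spanRank (segment ℝ (-v) v) = 1 := by
    rw [spanRank, span_segment_neg, finrank_span_singleton hv]
  have key : ∀ (ω : EuclideanSpace ℝ (Fin n) [⋀^Fin (spanRank (segment ℝ (-v) v))]→ₗ[ℝ] ℝ)
      (F : ℕ → Set (EuclideanSpace ℝ (Fin n))), IsProperFlag (segment ℝ (-v) v) F →
      |ω fun i => centroid (F i)| = |ω fun _ => v| := by
    intro ω F hF
    have hi : ∀ i : Fin (spanRank (segment ℝ (-v) v)), (i : ℕ) = 0 := fun i => by
      have := i.2
      omega
    have hlt : 0 < spanRank (segment ℝ (-v) v) := by omega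
    simp only [hi]
    rcases properFace_segment (hF.mem 0 hlt) (hF.nonempty hlt) with h | h
    · rw [h, centroid_singleton]
    · rw [h, centroid_singleton]
      have := ω.toMultilinearMap.map_smul_univ (fun _ => (-1 : ℝ)) (fun _ => v)
      simp only [neg_smul, one_smul, Finset.prod_const, Finset.card_univ, Fintype.card_fin, h1,
        pow_one] at this
      change ω _ = - ω _ at this
      rw [this, abs_neg]
  intro ω F G hF hG
  rw [key ω F hF, key ω G hG]

theorem FlagInvariant.l1Sum {A B : Set (EuclideanSpace ℝ (Fin n))} (hA : IsSymmetricConvex A)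
    (hB : IsSymmetricConvex B) (h : Disjoint (Submodule.span ℝ A) (Submodule.span ℝ B))
    (hfA : FlagInvariant centroid A) (hfB : FlagInvariant centroid B) :
    FlagInvariant centroid (l1Sum A B) := by
  apply FlagInvariant.of_properFaces
  have hrank : spanRank (HannerPolytope.l1Sum A B) = spanRank A + spanRank B :=
    spanRank_convexHull_union h
  have hface := fun X (hX : X ∈ properFaces (HannerPolytope.l1Sum A B)) =>
    l1Sum_face hA.convex hB.convex ⟨0, hA.zero_mem⟩ ⟨0, hB.zero_mem⟩ hX
  have hdis : ∀ X : Set (EuclideanSpace ℝ (Fin n)),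
      Disjoint (Submodule.span ℝ (X ∩ A)) (Submodule.span ℝ (X ∩ B)) := fun X =>
    h.mono (Submodule.span_mono Set.inter_subset_right) (Submodule.span_mono Set.inter_subset_right)
  rw [hrank]
  refine WedgeInvariant.prod (isRanked_properFaces A) (isRanked_properFaces B)
    (pA := fun X => X ∩ A) (pB := fun X => X ∩ B) ?_ ?_ ?_ ?_ ?_ ?_
    hfA.wedgeInvariant_properFaces hfB.wedgeInvariant_properFaces
  · intro X hX
    obtain ⟨l, h1, -, h2, -, -⟩ := hface X hX
    exact ⟨l, h1, h2⟩
  · intro X hX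
    obtain ⟨l, -, h1, -, h2, -⟩ := hface X hX
    exact ⟨l, h1, h2⟩
  · exact fun X _ Y _ hXY => Set.inter_subset_inter_left A hXY
  · exact fun X _ Y _ hXY => Set.inter_subset_inter_left B hXY
  · intro X hX
    obtain ⟨l, -, -, -, -, h1⟩ := hface X hX
    conv_lhs => rw [h1]
    exact spanRank_convexHull_union (hdis X)
  · intro X hX
    obtain ⟨l, -, -, hXA, hXB, h1⟩ := hface X hX
    have := spanRank_smul_centroid_convexHull_union
      (isCompact_of_eq_hyperplane_section hA.isCompact hXA) (convex_of_eq_hyperplane_section hA.convex hXA)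
      (isCompact_of_eq_hyperplane_section hB.isCompact hXB) (convex_of_eq_hyperplane_section hB.convex hXB)
      (hdis X) (l := l) (fun x hx => (hXA ▸ hx : x ∈ {x ∈ A | l x = 1}).2)
      (fun x hx => (hXB ▸ hx : x ∈ {x ∈ B | l x = 1}).2)
    rwa [← h1] at this

theorem FlagInvariant.lInftySum {A B : Set (EuclideanSpace ℝ (Fin n))} (hA : IsSymmetricConvex A)
    (hB : IsSymmetricConvex B) (h : Disjoint (Submodule.span ℝ A) (Submodule.span ℝ B))
    (hfA : FlagInvariant centroid A) (hfB : FlagInvariant centroid B) :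
    FlagInvariant centroid (lInftySum A B) := by
  have hAB := hA.add hB
  change FlagInvariant centroid (A + B)
  apply FlagInvariant.of_closedFaces hAB.zero_mem (centroid_eq_zero_of_neg_mem hAB.neg_mem)
  have hrank : spanRank (A + B) = spanRank A + spanRank B := by
    rw [spanRank, span_add_of_zero_mem hA.zero_mem hB.zero_mem, finrank_sup_of_disjoint h]
    rfl
  have hmA : ∀ X ∈ closedFaces (A + B), sumPart A B X ∈ closedFaces A := fun X hX =>
    sumPart_mem_closedFaces hX
  have hmB : ∀ X ∈ closedFaces (A + B), sumPart B A X ∈ closedFaces B := fun X hX =>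
    sumPart_mem_closedFaces (by rwa [add_comm])
  have hdis : ∀ X : Set (EuclideanSpace ℝ (Fin n)),
      Disjoint (vectorSpan ℝ (sumPart A B X)) (vectorSpan ℝ (sumPart B A X)) := fun X =>
    h.mono ((vectorSpan_le_span _).trans (Submodule.span_mono fun _ hx => hx.1))
      ((vectorSpan_le_span _).trans (Submodule.span_mono fun _ hx => hx.1))
  rw [hrank]
  refine WedgeInvariant.prod (isRanked_closedFaces A) (isRanked_closedFaces B) hmA hmB
    (fun X _ Y _ hXY => sumPart_mono A B hXY) (fun X _ Y _ hXY => sumPart_mono B A hXY) ?_ ?_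
    (hfA.wedgeInvariant_closedFaces hA.zero_mem hA.neg_mem (centroid_eq_zero_of_neg_mem hA.neg_mem))
    (hfB.wedgeInvariant_closedFaces hB.zero_mem hB.neg_mem (centroid_eq_zero_of_neg_mem hB.neg_mem))
  · intro X hX
    conv_lhs => rw [eq_sumPart_add_sumPart hX]
    exact dim_add (nonempty_of_mem_closedFaces (hmA X hX)) (nonempty_of_mem_closedFaces (hmB X hX))
      (hdis X)
  · intro X hX
    have hnA := nonempty_of_mem_closedFaces (hmA X hX)
    have hnB := nonempty_of_mem_closedFaces (hmB X hX)
    obtain ⟨l, c, -, hXA, -⟩ := hmA X hX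
    obtain ⟨m, d, -, hXB, -⟩ := hmB X hX
    conv_lhs => rw [eq_sumPart_add_sumPart hX]
    exact centroid_add (isCompact_of_eq_hyperplane_section hA.isCompact hXA)
      (convex_of_eq_hyperplane_section hA.convex hXA) hnA
      (isCompact_of_eq_hyperplane_section hB.isCompact hXB)
      (convex_of_eq_hyperplane_section hB.convex hXB) hnB (hdis X)

theorem IsHanner.flagInvariant {A : Set (EuclideanSpace ℝ (Fin n))} (h : IsHanner A) :
    FlagInvariant centroid A := by
  induction h with
  | interval v hv => exact flagInvariant_segment hv
  | l1 A B hA hB hAB ihA ihB =>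
    exact ihA.l1Sum hA.isSymmetricConvex hB.isSymmetricConvex hAB ihB
  | lInfty A B hA hB hAB ihA ihB =>
    exact ihA.lInftySum hA.isSymmetricConvex hB.isSymmetricConvex hAB ihB

theorem IsHannerBody.span_eq_top {H : Set (EuclideanSpace ℝ (Fin n))} (h : IsHannerBody H) :
    Submodule.span ℝ H = ⊤ := by
  have h1 := h.1.isSymmetricConvex
  rw [← vectorSpan_eq_span h1.zero_mem,
    ← AffineSubspace.affineSpan_eq_top_iff_vectorSpan_eq_top_of_nonempty ℝ _ _ ⟨0, h1.zero_mem⟩,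
    ← h1.convex.interior_nonempty_iff_affineSpan_eq_top]
  exact h.2

theorem IsFace.mem_properFaces {H X : Set (EuclideanSpace ℝ (Fin n))} (hH : IsHannerBody H)
    (hX : IsFace H X) : X ∈ properFaces H := by
  have hs := hH.1.isSymmetricConvex
  obtain ⟨l, a, hl, hle, hXe, hn⟩ := hX
  refine closedFaces_mem_properFaces hs.zero_mem hs.neg_mem ⟨l, a, hle, hXe, hn⟩ ?_
  rintro rfl
  apply hl
  have hconst : ∀ x ∈ X, l x = a := fun x hx => by
    rw [hXe] at hx
    exact hx.2
  have ha : a = 0 := by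
    rw [← hconst 0 hs.zero_mem, map_zero]
  apply LinearMap.ext_on hH.span_eq_top
  intro x hx
  rw [hconst x hx, ha, LinearMap.zero_apply]

theorem volume_flagSimplex (F : Fin n → Set (EuclideanSpace ℝ (Fin n))) :
    volume (flagSimplex F) =
      ENNReal.ofReal |(EuclideanSpace.basisFun (Fin n) ℝ).toBasis.det fun k => centroid (F k)| *
        volume (convexHull ℝ (insert 0 (Set.range (EuclideanSpace.basisFun (Fin n) ℝ)))) := by
  set b := (EuclideanSpace.basisFun (Fin n) ℝ).toBasis with hb
  set L := b.constr ℝ fun k => centroid (F k) with hL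
  have h1 : flagSimplex F =
      L '' convexHull ℝ (insert 0 (Set.range (EuclideanSpace.basisFun (Fin n) ℝ))) := by
    rw [L.image_convexHull, Set.image_insert_eq, map_zero, ← Set.range_comp]
    have : (L ∘ (EuclideanSpace.basisFun (Fin n) ℝ)) = fun k => centroid (F k) := by
      ext1 k
      have := b.constr_basis ℝ (fun k => centroid (F k)) k
      rw [hb, OrthonormalBasis.coe_toBasis] at this
      exact this
    rw [this]
    rfl
  have h2 : LinearMap.det L = b.det fun k => centroid (F k) := by
    have := b.det_comp L b
    rw [b.det_self, mul_one] at this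
    rw [← this]
    congr 1
    ext1 k
    exact b.constr_basis ℝ (fun k => centroid (F k)) k
  rw [h1, Measure.addHaar_image_linearMap, h2]

theorem IsFlag.isProperFlag {H : Set (EuclideanSpace ℝ (Fin n))} (hH : IsHannerBody H)
    (hn : spanRank H = n) {F : Fin n → Set (EuclideanSpace ℝ (Fin n))} (hF : IsFlag H F) :
    IsProperFlag H fun k => if hk : k < n then F ⟨k, hk⟩ else ∅ where
  mem k hk := by
    rw [hn] at hk
    simp only [hk, dif_pos]
    exact (hF.isFace _).mem_properFaces hH
  rank k hk := by
    rw [hn] at hk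
    simp only [hk, dif_pos]
    have hface := hF.isFace ⟨k, hk⟩
    rw [spanRank_eq_dim_add_one_of_mem (hface.mem_properFaces hH)
      (by obtain ⟨_, _, _, _, _, h⟩ := hface; exact h), hF.dim_eq]
  mono i j hij hj := by
    rw [hn] at hj
    simp only [hj, hij.trans_lt hj, dif_pos]
    exact hF.mono hij

theorem IsFlag.abs_det_eq {H : Set (EuclideanSpace ℝ (Fin n))} (hH : IsHannerBody H)
    {F G : Fin n → Set (EuclideanSpace ℝ (Fin n))} (hF : IsFlag H F) (hG : IsFlag H G)
    (ω : EuclideanSpace ℝ (Fin n) [⋀^Fin n]→ₗ[ℝ] ℝ) :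
    |ω fun k => centroid (F k)| = |ω fun k => centroid (G k)| := by
  have hn : spanRank H = n := by
    rw [spanRank, hH.span_eq_top, finrank_top, finrank_euclideanSpace_fin]
  have h := hH.1.flagInvariant (ω.domDomCongr (finCongr hn.symm)) _ _ (hF.isProperFlag hH hn)
    (hG.isProperFlag hH hn)
  have hcomp : ∀ E : Fin n → Set (EuclideanSpace ℝ (Fin n)),
      ((fun i : Fin (spanRank H) => centroid (if hk : (i : ℕ) < n then E ⟨i, hk⟩ else ∅)) ∘
        finCongr hn.symm) = fun k => centroid (E k) := fun E => by
    ext1 k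
    simp
  rw [AlternatingMap.domDomCongr_apply, AlternatingMap.domDomCongr_apply, hcomp, hcomp] at h
  exact h

end HannerPolytope

end

theorem mainTheorem4 (n : ℕ) (H : Set (EuclideanSpace ℝ (Fin n)))
    (hH : HannerPolytope.IsHannerBody H)
    (F G : Fin n → Set (EuclideanSpace ℝ (Fin n)))
    (hF : HannerPolytope.IsFlag H F) (hG : HannerPolytope.IsFlag H G) :
    MeasureTheory.volume (HannerPolytope.flagSimplex F) =
      MeasureTheory.volume (HannerPolytope.flagSimplex G) := by
  rw [HannerPolytope.volume_flagSimplex, HannerPolytope.volume_flagSimplex, hF.abs_det_eq hH hG]
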